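/- Let $(P,\eta)$ be a contact manifold of dimension $2n+1$ ($\eta$ is a $1$-form with $\Omega=\eta\wedge(d\eta)^n$ nowhere zero), let $H:P\to\mathbb R$ be smooth, $M\subseteq P$ an embedded submanifold, and $F$ a regular distribution on $P$ along $M$ (a smooth vector subbundle of $T_MP=TP|_M$), with annihilator $F^\circ$. Let $\flat(v)=\iota_v d\eta+\eta(v)\eta$, let $R=\flat^{-1}(\eta)$ be the Reeb vector field, $X_H=\flat^{-1}\bigl(dH-(R(H)+H)\eta\bigr)$ the Hamiltonian vector field and ${}^{\perp}F=\flat^{-1}(F^\circ)$. Assume (mechanical condition) $dH|_M$ annihilates ${}^{\perp}F$; (uniqueness) ${}^{\perp}F\cap TM=\{0\}$; and $\operatorname{rank}F=\dim M$. Let $X$ be a smooth vector field on $P$ which solves the constrained Herglotz equations: along $M$, $\flat(X)-dH+(H+R(H))\eta\in F^\circ$ and $X$ is tangent to $M$. Then $T_MP={}^{\perp}F\oplus TM$. With the corresponding projectors $\mathcal P:T_MP\to TM$ and $\mathcal Q:T_MP\to{}^{\perp}F$ one has $X|_M=\mathcal P(X_H|_M)$, and $X_H-X$ is a smooth extension of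 $\mathcal Q(X_H)$ to $P$. At every point of $M$, $$\mathcal L_XH=-R(H)H-\mathcal L_{\mathcal Q(X_H)}H .$$ Let $Z$ be any smooth vector field on $P$ with $Z|_M=\mathcal Q(X_H)$. (a) On vectors tangent to $M$, $\mathcal L_X\eta=-R(H)\eta-\mathcal L_Z\eta$ and, if $H$ does not vanish and $\tilde\eta=\eta/H$, $\mathcal L_X\tilde\eta=-\frac1H\mathcal L_Z\eta$. (b) If moreover $X+Z=X_H$ in a neighbourhood of $M$ (for instance $Z=X_H-X$), then at every point of $M$, as forms on $T_MP$, $$\mathcal L_X\eta=-R(H)\eta-\mathcal L_Z\eta,$$ $$\mathcal L_X\Omega=-(n+1)R(H)\Omega-\mathcal L_Z\eta\wedge(d\eta)^n-n\,\eta\wedge(d\eta)^{n-1}\wedge d\mathcal L_Z\eta,$$ and, if $H$ does not vanish, with $\tilde\Omega=\tilde\eta\wedge(d\tilde\eta)^n$, $$\mathcal L_X\tilde\eta=-\tfrac1H\mathcal L_Z\eta,\qquad \mathcal L_X\tilde\Omega=-\mathcal L_Z\tilde\eta\wedge(d\tilde\eta)^n-n\,\tilde\eta\wedge(d\tilde\eta)^{n-1}\wedge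 d\mathcal L_Z\tilde\eta .$$ (For $n=0$ the terms with the factor $n$ are zero.) (c) If $R\in F$ along $M$, then $\mathcal L_Z\eta$ vanishes on $F\cap TM$. If in addition $\eta(Z)=0$ in a neighbourhood of $M$, then $\mathcal L_Z\eta\in F^\circ$ along $M$; and if also $X+Z=X_H$ in a neighbourhood of $M$, then at every point of $M$ $$\mathcal L_X\Omega=-(n+1)R(H)\Omega-n\,\eta\wedge(d\eta)^{n-1}\wedge d\mathcal L_Z\eta,\qquad \mathcal L_X\tilde\Omega=-n\,\tilde\eta\wedge(d\tilde\eta)^{n-1}\wedge d\mathcal L_Z\tilde\eta,$$ the last one if $H$ does not vanish. -/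

import Mathlib

open scoped Manifold ContDiff Topology

noncomputable section

namespace ContactNonholonomic

theorem castAdd_ne_natAdd {k l : ℕ} (i : Fin k) (j : Fin l) :
    Fin.castAdd l i ≠ Fin.natAdd k j := by
  intro h
  have := congrArg Fin.val h
  simp only [Fin.val_castAdd, Fin.val_natAdd] at this
  omega

theorem update_pair_zero {W : Type*} (v w z : W) : Function.update ![v, w] 0 z = ![z, w] := by
  funext i; fin_cases i <;> simp

theorem update_pair_one {W : Type*} (v w z : W) : Function.update ![v, w] 1 z = ![v, z] := by
  funext i; fin_cases i <;> simp

section Algebra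

variable {V : Type*} [AddCommGroup V] [Module ℝ V] [TopologicalSpace V]

/-- The tensor product `α ⊗ β` of two alternating forms, as a continuous multilinear map:
`(v₁, …, v_{k+l}) ↦ α(v₁, …, v_k) β(v_{k+1}, …, v_{k+l})`. -/
def tensorForm {k l : ℕ} (α : V [⋀^Fin k]→L[ℝ] ℝ) (β : V [⋀^Fin l]→L[ℝ] ℝ) :
    ContinuousMultilinearMap ℝ (fun _ : Fin (k + l) => V) ℝ where
  toFun v := α (fun i => v (Fin.castAdd l i)) * β (fun j => v (Fin.natAdd k j))
  map_update_add' := by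
    intro _ v i x y
    induction i using Fin.addCases with
    | left i =>
      have h1 (z : V) : (fun a => Function.update v (Fin.castAdd l i) z (Fin.castAdd l a)) =
          Function.update (fun a => v (Fin.castAdd l a)) i z := by
        funext a; simp [Function.update_apply]
      have h2 (z : V) : (fun a => Function.update v (Fin.castAdd l i) z (Fin.natAdd k a)) =
          fun a => v (Fin.natAdd k a) := by
        funext a
        exact Function.update_of_ne (Ne.symm (castAdd_ne_natAdd i a)) _ _
      rw [h1, h1, h1, h2, h2, h2, α.map_update_add, add_mul]
    | right i =>
      have h1 (z : V) : (fun a => Function.update v (Fin.natAdd k i) z (Fin.natAdd k a)) =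
          Function.update (fun a => v (Fin.natAdd k a)) i z := by
        funext a; simp [Function.update_apply]
      have h2 (z : V) : (fun a => Function.update v (Fin.natAdd k i) z (Fin.castAdd l a)) =
          fun a => v (Fin.castAdd l a) := by
        funext a
        exact Function.update_of_ne (castAdd_ne_natAdd a i) _ _
      rw [h1, h1, h1, h2, h2, h2, β.map_update_add, mul_add]
  map_update_smul' := by
    intro _ v i c x
    induction i using Fin.addCases with
    | left i =>
      have h1 (z : V) : (fun a => Function.update v (Fin.castAdd l i) z (Fin.castAdd l a)) =
          Function.update (fun a => v (Fin.castAdd l a)) i z := by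
        funext a; simp [Function.update_apply]
      have h2 (z : V) : (fun a => Function.update v (Fin.castAdd l i) z (Fin.natAdd k a)) =
          fun a => v (Fin.natAdd k a) := by
        funext a
        exact Function.update_of_ne (Ne.symm (castAdd_ne_natAdd i a)) _ _
      rw [h1, h1, h2, h2, α.map_update_smul, smul_eq_mul, smul_eq_mul, mul_assoc]
    | right i =>
      have h1 (z : V) : (fun a => Function.update v (Fin.natAdd k i) z (Fin.natAdd k a)) =
          Function.update (fun a => v (Fin.natAdd k a)) i z := by
        funext a; simp [Function.update_apply]
      have h2 (z : V) : (fun a => Function.update v (Fin.natAdd k i) z (Fin.castAdd l a)) =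
          fun a => v (Fin.castAdd l a) := by
        funext a
        exact Function.update_of_ne (castAdd_ne_natAdd a i) _ _
      rw [h1, h1, h2, h2, β.map_update_smul, smul_eq_mul, smul_eq_mul, mul_left_comm]
  cont := by
    refine Continuous.mul (α.cont.comp ?_) (β.cont.comp ?_)
    · exact continuous_pi fun i => continuous_apply _
    · exact continuous_pi fun i => continuous_apply _

/-- The wedge product of alternating forms, `α ∧ β = (1 / (k! l!)) ∑_σ sign(σ) (α ⊗ β) ∘ σ`. -/
def wedge {k l : ℕ} (α : V [⋀^Fin k]→L[ℝ] ℝ) (β : V [⋀^Fin l]→L[ℝ] ℝ) :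
    V [⋀^Fin (k + l)]→L[ℝ] ℝ :=
  ((k.factorial * l.factorial : ℝ)⁻¹) •
    ContinuousMultilinearMap.alternatization (tensorForm α β)

/-- The wedge power `β ∧ ⋯ ∧ β` (`m` factors) of a 2-form. -/
def wedgePow (β : V [⋀^Fin 2]→L[ℝ] ℝ) : (m : ℕ) → V [⋀^Fin (2 * m)]→L[ℝ] ℝ
  | 0 => haveI : IsEmpty (Fin (2 * 0)) := inferInstanceAs (IsEmpty (Fin 0))
    ContinuousAlternatingMap.constOfIsEmpty ℝ V (Fin (2 * 0)) 1
  | m + 1 => wedge (wedgePow β m) β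

/-- `n α ∧ β ^ (n - 1) ∧ γ` for a 1-form `α` and 2-forms `β`, `γ`; it is `0` when `n = 0`. -/
def wedgeCross (α : V [⋀^Fin 1]→L[ℝ] ℝ) (β γ : V [⋀^Fin 2]→L[ℝ] ℝ) :
    (n : ℕ) → V [⋀^Fin (1 + 2 * n)]→L[ℝ] ℝ
  | 0 => 0
  | m + 1 => ((m + 1 : ℕ) : ℝ) • wedge (wedge α (wedgePow β m)) γ

/-- A form of degree one as a linear functional. -/
def oneForm (α : V [⋀^Fin 1]→L[ℝ] ℝ) : Module.Dual ℝ V :=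
  ((ContinuousAlternatingMap.ofSubsingleton ℝ V ℝ (0 : Fin 1)).symm α : V →L[ℝ] ℝ)

/-- The linear map `v ↦ ι_v β + α(v) α` attached to a 1-form `α` and a 2-form `β`. -/
def flatMap (α : V [⋀^Fin 1]→L[ℝ] ℝ) (β : V [⋀^Fin 2]→L[ℝ] ℝ) : V →ₗ[ℝ] Module.Dual ℝ V :=
  LinearMap.mk₂ ℝ (fun v w => β ![v, w] + oneForm α v * oneForm α w)
    (fun v v' w => by
      have h := β.map_update_add ![v, w] 0 v v'
      simp only [update_pair_zero] at h
      rw [h, map_add]; ring)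
    (fun c v w => by
      have h := β.map_update_smul ![v, w] 0 c v
      simp only [update_pair_zero] at h
      rw [h, map_smul, smul_eq_mul, smul_eq_mul, smul_eq_mul]; ring)
    (fun v w w' => by
      have h := β.map_update_add ![v, w] 1 w w'
      simp only [update_pair_one] at h
      rw [h, map_add]; ring)
    (fun c v w => by
      have h := β.map_update_smul ![v, w] 1 c w
      simp only [update_pair_one] at h
      rw [h, map_smul, smul_eq_mul, smul_eq_mul, smul_eq_mul]; ring)

end Algebra

/-- Lie derivative of a `k`-form `θ` along a vector field `X` on a vector space:
`(L_X θ)_y (v₁, …, v_k) = (D_X θ)_y (v₁, …, v_k) + ∑ i, θ_y (v₁, …, DX_y v_i, …, v_k)`. -/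
def lieDerivForm {E : Type*} [NormedAddCommGroup E] [NormedSpace ℝ E] {k : ℕ}
    (X : E → E) (θ : E → E [⋀^Fin k]→L[ℝ] ℝ) (y : E) : E [⋀^Fin k]→L[ℝ] ℝ :=
  fderiv ℝ θ y (X y) +
    (θ y).fderivCompContinuousLinearMap (ContinuousLinearMap.id ℝ E) (fderiv ℝ X y)

section Forms

variable {E : Type*} [NormedAddCommGroup E] [NormedSpace ℝ E]
  {P : Type*} [TopologicalSpace P] [ChartedSpace E P]

variable (E P) in
/-- (Not necessarily smooth) differential `k`-forms on the manifold `P` modelled on `E`. -/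
abbrev DForm (k : ℕ) : Type _ := ∀ x : P, TangentSpace 𝓘(ℝ, E) x [⋀^Fin k]→L[ℝ] ℝ

variable (E P) in
/-- (Not necessarily smooth) vector fields on the manifold `P` modelled on `E`. -/
abbrev VField : Type _ := ∀ x : P, TangentSpace 𝓘(ℝ, E) x

/-- The coordinate expression of a form in the preferred chart at `x₀`, that is, its pullback
under the inverse of that chart. -/
def chartForm {k : ℕ} (x₀ : P) (θ : DForm E P k) : E → E [⋀^Fin k]→L[ℝ] ℝ := fun y =>
  (θ ((extChartAt 𝓘(ℝ, E) x₀).symm y)).compContinuousLinearMap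
    (mfderiv 𝓘(ℝ, E) 𝓘(ℝ, E) (extChartAt 𝓘(ℝ, E) x₀).symm y)

/-- The coordinate expression of a vector field in the preferred chart at `x₀`. -/
def chartVField (x₀ : P) (X : VField E P) : E → E := fun y =>
  VectorField.mpullback 𝓘(ℝ, E) 𝓘(ℝ, E) (extChartAt 𝓘(ℝ, E) x₀).symm X y

/-- Pullback to `T_x P` of an alternating form on the model space, by the derivative of the
preferred chart at `x`. -/
def fromChart {k : ℕ} (x : P) (α : E [⋀^Fin k]→L[ℝ] ℝ) :
    TangentSpace 𝓘(ℝ, E) x [⋀^Fin k]→L[ℝ] ℝ :=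
  ContinuousAlternatingMap.compContinuousLinearMap α
    (mfderiv 𝓘(ℝ, E) 𝓘(ℝ, E) (extChartAt 𝓘(ℝ, E) x) x)

/-- A form is smooth if all its coordinate expressions are. -/
def IsSmoothForm {k : ℕ} (θ : DForm E P k) : Prop :=
  ∀ x₀ : P, ContDiffOn ℝ ∞ (chartForm x₀ θ) (extChartAt 𝓘(ℝ, E) x₀).target

/-- A vector field is smooth if it is a smooth section of the tangent bundle. -/
def IsSmoothVField [IsManifold 𝓘(ℝ, E) ∞ P] (X : VField E P) : Prop :=
  ContMDiff 𝓘(ℝ, E) 𝓘(ℝ, E).tangent ∞ (fun x => (⟨x, X x⟩ : TangentBundle 𝓘(ℝ, E) P))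

/-- The exterior derivative on `P`, computed at `x` in the preferred chart at `x`. -/
def d {k : ℕ} (θ : DForm E P k) : DForm E P (k + 1) := fun x =>
  fromChart x (extDeriv (chartForm x θ) (extChartAt 𝓘(ℝ, E) x x))

/-- The Lie derivative `L_X θ` on `P`, computed at `x` in the preferred chart at `x`. -/
def lieD {k : ℕ} (X : VField E P) (θ : DForm E P k) : DForm E P k := fun x =>
  fromChart x (lieDerivForm (chartVField x X) (chartForm x θ) (extChartAt 𝓘(ℝ, E) x x))

/-- The differential of a real function, `dH : T_x P → ℝ`. Its value on `X x` is the Lie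
derivative `L_X H = X(H)`. -/
def dFun (H : P → ℝ) (x : P) : Module.Dual ℝ (TangentSpace 𝓘(ℝ, E) x) :=
  (mfderiv 𝓘(ℝ, E) 𝓘(ℝ, ℝ) H x).toLinearMap

/-- The form `Ω = η ∧ (dη) ^ n`. -/
def volumeForm (n : ℕ) (η : DForm E P 1) : DForm E P (1 + 2 * n) := fun x =>
  wedge (η x) (wedgePow (d η x) n)

/-- `η` is a contact form on the `(2n+1)`-dimensional manifold `P`: it is smooth and
`η ∧ (dη) ^ n` is nowhere zero. -/
structure IsContactForm (n : ℕ) (η : DForm E P 1) : Prop where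
  finrank_eq : Module.finrank ℝ E = 2 * n + 1
  smooth : IsSmoothForm η
  volume_ne_zero : ∀ x, volumeForm n η x ≠ 0

/-- `♭(v) = ι_v dη + η(v) η`. -/
def flat (η : DForm E P 1) (x : P) :
    TangentSpace 𝓘(ℝ, E) x →ₗ[ℝ] Module.Dual ℝ (TangentSpace 𝓘(ℝ, E) x) :=
  flatMap (η x) (d η x)

/-- `♯ = ♭⁻¹` (for a contact form, `♭` is bijective). -/
def sharp (η : DForm E P 1) (x : P) :
    Module.Dual ℝ (TangentSpace 𝓘(ℝ, E) x) → TangentSpace 𝓘(ℝ, E) x :=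
  Function.invFun (flat η x)

/-- The Reeb vector field `R = ♯(η)`. -/
def reeb (η : DForm E P 1) : VField E P := fun x => sharp η x (oneForm (η x))

/-- `dH - (R(H) + H) η`. -/
def herglotzForm (η : DForm E P 1) (H : P → ℝ) (x : P) :
    Module.Dual ℝ (TangentSpace 𝓘(ℝ, E) x) :=
  dFun H x - (dFun H x (reeb η x) + H x) • oneForm (η x)

/-- The Hamiltonian vector field, `♭(X_H) = dH - (R(H) + H) η`. -/
def hamVField (η : DForm E P 1) (H : P → ℝ) : VField E P := fun x =>
  sharp η x (herglotzForm η H x)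

end Forms

section Constrained

variable {E : Type*} [NormedAddCommGroup E] [NormedSpace ℝ E]
  {P : Type*} [TopologicalSpace P] [ChartedSpace E P] [IsManifold 𝓘(ℝ, E) ∞ P]
  {E' : Type*} [NormedAddCommGroup E'] [NormedSpace ℝ E']
  {M : Type*} [TopologicalSpace M] [ChartedSpace E' M]

/-- `F` is a smooth regular distribution of rank `k` on `P` along `ι : M → P`, i.e. a rank `k`
vector subbundle of `ι^* TP`: near every point of `M` it is spanned by `k` smooth, pointwise
linearly independent vector fields along `ι`. -/
def IsRegularDistributionAlong (ι : M → P) (k : ℕ)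
    (F : ∀ m : M, Submodule ℝ (TangentSpace 𝓘(ℝ, E) (ι m))) : Prop :=
  ∀ m₀ : M, ∃ U ∈ 𝓝 m₀, ∃ s : Fin k → ∀ m : M, TangentSpace 𝓘(ℝ, E) (ι m),
    (∀ i, ContMDiffOn 𝓘(ℝ, E') 𝓘(ℝ, E).tangent ∞
      (fun m => (⟨ι m, s i m⟩ : TangentBundle 𝓘(ℝ, E) P)) U) ∧
    ∀ m ∈ U, LinearIndependent ℝ (fun i => s i m) ∧
      Submodule.span ℝ (Set.range fun i => s i m) = F m

variable (E P E' M) in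
/-- A constrained Hamiltonian system `(P, η, H, M, F)`: a `(2n+1)`-dimensional contact manifold
`(P, η)`, a smooth function `H`, an embedded submanifold `ι : M → P`, and a smooth regular
distribution `F` on `P` along `M`. -/
structure ConstrainedHamiltonianSystem (n : ℕ) where
  η : DForm E P 1
  contact : IsContactForm n η
  H : P → ℝ
  smooth_H : ContMDiff 𝓘(ℝ, E) 𝓘(ℝ, ℝ) ∞ H
  ι : M → P
  embedding : Manifold.IsSmoothEmbedding 𝓘(ℝ, E') 𝓘(ℝ, E) ∞ ι
  rankF : ℕ
  F : ∀ m : M, Submodule ℝ (TangentSpace 𝓘(ℝ, E) (ι m))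
  regular_F : IsRegularDistributionAlong (E' := E') ι rankF F

namespace ConstrainedHamiltonianSystem

variable {n : ℕ} (S : ConstrainedHamiltonianSystem E P E' M n)

/-- The Reeb vector field. -/
def R : VField E P := reeb S.η

/-- The function `R(H)`. -/
def RH (x : P) : ℝ := dFun S.H x (S.R x)

/-- The Hamiltonian vector field `X_H`. -/
def XH : VField E P := hamVField S.η S.H

/-- The tangent space of `M`, as a subspace of the tangent space of `P`. -/
def TM (m : M) : Submodule ℝ (TangentSpace 𝓘(ℝ, E) (S.ι m)) :=
  LinearMap.range (mfderiv 𝓘(ℝ, E') 𝓘(ℝ, E) S.ι m).toLinearMap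

/-- The left complement `♭⁻¹(F°)` of `F`. -/
def orthL (m : M) : Submodule ℝ (TangentSpace 𝓘(ℝ, E) (S.ι m)) :=
  (S.F m).dualAnnihilator.comap (flat S.η (S.ι m))

/-- The mechanical condition: at points of `M`, `dH` annihilates the left complement of `F`. -/
def MechanicalCondition : Prop :=
  ∀ m, dFun S.H (S.ι m) ∈ (S.orthL m).dualAnnihilator

open Classical in
/-- The projector `𝒫 : T_M P → TM` of the splitting of `T_M P` into the left complement of `F`
and `TM` (and `0` where there is no such splitting). -/
def projP (m : M) : TangentSpace 𝓘(ℝ, E) (S.ι m) →ₗ[ℝ] TangentSpace 𝓘(ℝ, E) (S.ι m) :=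
  if h : IsCompl (S.orthL m) (S.TM m) then (S.TM m).projection (S.orthL m) h.symm else 0

open Classical in
/-- The projector `𝒬` of `T_M P` onto the left complement of `F`, for the same splitting. -/
def projQ (m : M) : TangentSpace 𝓘(ℝ, E) (S.ι m) →ₗ[ℝ] TangentSpace 𝓘(ℝ, E) (S.ι m) :=
  if h : IsCompl (S.orthL m) (S.TM m) then (S.orthL m).projection (S.TM m) h else 0

/-- The constrained Herglotz equations for a vector field `X` on `P`: along `M`,
`♭(X) - dH + (H + R(H)) η ∈ F°`, and `X` is tangent to `M`. -/
structure SolvesConstrainedHerglotz (X : VField E P) : Prop where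
  smooth : IsSmoothVField X
  equation : ∀ m, flat S.η (S.ι m) (X (S.ι m)) - dFun S.H (S.ι m) +
    (S.H (S.ι m) + S.RH (S.ι m)) • oneForm (S.η (S.ι m)) ∈ (S.F m).dualAnnihilator
  tangent : ∀ m, X (S.ι m) ∈ S.TM m

/-- `Z` is a smooth vector field on `P` which extends `𝒬(X_H)`. -/
structure ExtendsQXH (Z : VField E P) : Prop where
  smooth : IsSmoothVField Z
  eq_on : ∀ m, Z (S.ι m) = S.projQ m (S.XH (S.ι m))

/-- `X + Z = X_H` in a neighbourhood of `M`. -/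
def SplitsXHNear (X Z : VField E P) : Prop :=
  ∀ m, ∀ᶠ y in 𝓝 (S.ι m), X y + Z y = S.XH y

/-- `η(Z) = 0` in a neighbourhood of `M`. -/
def HorizontalNear (Z : VField E P) : Prop :=
  ∀ m, ∀ᶠ y in 𝓝 (S.ι m), oneForm (S.η y) (Z y) = 0

/-- The contact volume `Ω = η ∧ (dη) ^ n`. -/
def Ω : DForm E P (1 + 2 * n) := volumeForm n S.η

/-- The rescaled 1-form `η / H`. -/
def ηTilde : DForm E P 1 := fun x => (S.H x)⁻¹ • S.η x

/-- The rescaled volume `(η / H) ∧ (d (η / H)) ^ n`. -/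
def ΩTilde : DForm E P (1 + 2 * n) := volumeForm n S.ηTilde

end ConstrainedHamiltonianSystem

end Constrained

end ContactNonholonomic

end

open ContactNonholonomic

/-!
The Hamiltonian vector field of a contact form is characterized by `η(X_H) = -H` and
`ι_{X_H} dη = dH - R(H) η`, so that Cartan's formula gives `L_{X_H} η = -R(H) η` and, where `H` does
not vanish, `L_{X_H} (η / H) = 0`. A solution `X` of the constrained Herglotz equations differs
from `X_H` along `M` by an element of `♭⁻¹(F°)`, because `♭(X) - ♭(X_H) ∈ F°`. As `♭` is bijective,
`♭⁻¹(F°)` has dimension `dim P - rank F = dim P - dim M`, hence it is a complement of `TM` as soon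
as it meets `TM` trivially (`isCompl_comap_dualAnnihilator`), and `X`, `X_H - X` are the two
components of `X_H`. The mechanical condition says that the second component does not change the
energy.

All formulas for Lie derivatives come from comparing `L_X + L_Z` with `L_{X_H}`. When `X + Z = X_H`
holds only along `M`, Cartan's formula shows that the two sides agree on vectors tangent to `M`
(`lieD_one_apply_eq_of_eqOn_range`). When it holds near `M`, they agree on all vectors, and the
Leibniz rule for `θ ∧ (dθ) ^ n` together with `d L_X = L_X d` gives the formulas for the volumes
(`lieD_volumeForm_of_eventually`); the summand `dR(H) ∧ η` of `d(R(H) η)` disappears since it is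
multiplied by `η`. If the Reeb field lies in `F`, then `η(Z) = ♭(Z)(R) = 0` along `M`. If `η(Z) = 0`
even near `M`, then `L_Z η = ι_Z dη = ♭(Z) ∈ F°`, and `ι_Z dη ∧ (dη) ^ n` is zero, because it is a
form of top degree annihilated by the kernel of `dη`
(`wedge_wedgePow_eq_zero_of_contraction`).

The exterior and Lie derivatives are defined at each point in the preferred chart at that point.
That they can be computed in any preferred chart (`chartForm_d`, `chartForm_lieD`) reduces the
calculus on `P` to calculus on the model space. Smoothness of `R` and `X_H` follows by inverting the
smooth family of linear maps `♭` in charts (`IsContactForm.isSmoothVField_of_flat`).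
-/

namespace ContactNonholonomic

/-! ### Alternating sums -/

section AltSum

variable {V : Type*}

/-- The signed sum `∑ σ, sign σ • f (w ∘ σ)` over all permutations of the arguments, for an
arbitrary real function `f` of `N` vectors. -/
noncomputable def altSum {N : ℕ} (f : (Fin N → V) → ℝ) (w : Fin N → V) : ℝ :=
  ∑ σ : Equiv.Perm (Fin N), Equiv.Perm.sign σ • f (w ∘ σ)

theorem altSum_comp_perm {N : ℕ} (f : (Fin N → V) → ℝ) (τ : Equiv.Perm (Fin N))
    (w : Fin N → V) :
    altSum (fun u => f (u ∘ τ)) w = Equiv.Perm.sign τ • altSum f w := by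
  unfold altSum
  rw [Finset.smul_sum]
  refine Fintype.sum_equiv (Equiv.mulRight τ) _ _ fun σ => ?_
  rw [Equiv.coe_mulRight, Equiv.Perm.sign_mul, smul_smul, mul_comm (Equiv.Perm.sign σ), ← mul_assoc,
    Int.units_mul_self, one_mul]
  rfl

theorem altSum_const_mul {N : ℕ} (c : ℝ) (f : (Fin N → V) → ℝ) (w : Fin N → V) :
    altSum (fun u => c * f u) w = c * altSum f w := by
  simp only [altSum, Finset.mul_sum, mul_smul_comm]

theorem altSum_fintypeSum {N : ℕ} {T : Type*} [Fintype T] (f : T → (Fin N → V) → ℝ)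
    (w : Fin N → V) : altSum (fun u => ∑ t, f t u) w = ∑ t, altSum (f t) w := by
  simp only [altSum, Finset.smul_sum]
  exact Finset.sum_comm

/-- The permutation of `Fin (k + l)` which permutes the first `k` and the last `l` indices
separately. -/
def blockPerm {k l : ℕ} (σ : Equiv.Perm (Fin k)) (τ : Equiv.Perm (Fin l)) :
    Equiv.Perm (Fin (k + l)) :=
  finSumFinEquiv.permCongr (Equiv.Perm.sumCongr σ τ)

theorem sign_blockPerm {k l : ℕ} (σ : Equiv.Perm (Fin k)) (τ : Equiv.Perm (Fin l)) :
    Equiv.Perm.sign (blockPerm σ τ) = Equiv.Perm.sign σ * Equiv.Perm.sign τ := by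
  rw [blockPerm, Equiv.Perm.sign_permCongr, Equiv.Perm.sign_sumCongr]

theorem blockPerm_castAdd {k l : ℕ} (σ : Equiv.Perm (Fin k)) (τ : Equiv.Perm (Fin l)) (i : Fin k) :
    blockPerm σ τ (Fin.castAdd l i) = Fin.castAdd l (σ i) := by
  simp [blockPerm, Equiv.permCongr_apply]

theorem blockPerm_natAdd {k l : ℕ} (σ : Equiv.Perm (Fin k)) (τ : Equiv.Perm (Fin l)) (j : Fin l) :
    blockPerm σ τ (Fin.natAdd k j) = Fin.natAdd k (τ j) := by
  simp [blockPerm, Equiv.permCongr_apply]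

/-- The product of a function of the first `k` and a function of the last `l` arguments. -/
def blockMul {k l : ℕ} (f : (Fin k → V) → ℝ) (g : (Fin l → V) → ℝ) (u : Fin (k + l) → V) : ℝ :=
  f (u ∘ Fin.castAdd l) * g (u ∘ Fin.natAdd k)

theorem blockMul_comp_blockPerm {k l : ℕ} (f : (Fin k → V) → ℝ) (g : (Fin l → V) → ℝ)
    (σ : Equiv.Perm (Fin k)) (τ : Equiv.Perm (Fin l)) (u : Fin (k + l) → V) :
    blockMul f g (u ∘ blockPerm σ τ) = blockMul (fun v => f (v ∘ σ)) (fun v => g (v ∘ τ)) u := by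
  have h1 : (u ∘ blockPerm σ τ) ∘ Fin.castAdd l = (u ∘ Fin.castAdd l) ∘ σ := by
    funext i; simp [blockPerm_castAdd]
  have h2 : (u ∘ blockPerm σ τ) ∘ Fin.natAdd k = (u ∘ Fin.natAdd k) ∘ τ := by
    funext i; simp [blockPerm_natAdd]
  simp only [blockMul, h1, h2]

/-- Antisymmetrizing the first `k` arguments before antisymmetrizing all of them only multiplies the
result by `k!`; this is what makes the wedge product associative. -/
theorem altSum_blockMul_altSum_left {k l : ℕ} (f : (Fin k → V) → ℝ) (g : (Fin l → V) → ℝ)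
    (w : Fin (k + l) → V) :
    altSum (blockMul (altSum f) g) w = k.factorial * altSum (blockMul f g) w := by
  have h : blockMul (altSum f) g = fun u => ∑ τ : Equiv.Perm (Fin k),
      (Equiv.Perm.sign τ : ℤ) * blockMul f g (u ∘ blockPerm τ 1) := by
    funext u
    simp only [blockMul_comp_blockPerm]
    simp only [blockMul, altSum, Finset.sum_mul, Units.smul_def, zsmul_eq_mul, mul_assoc]
    rfl
  rw [h, altSum_fintypeSum]
  simp only [altSum_const_mul, altSum_comp_perm, sign_blockPerm, Equiv.Perm.sign_one, mul_one,
    Units.smul_def, zsmul_eq_mul]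
  simp only [← mul_assoc, ← Int.cast_mul, ← Units.val_mul, Int.units_mul_self]
  simp [Fintype.card_perm]

theorem altSum_blockMul_altSum_right {k l : ℕ} (f : (Fin k → V) → ℝ) (g : (Fin l → V) → ℝ)
    (w : Fin (k + l) → V) :
    altSum (blockMul f (altSum g)) w = l.factorial * altSum (blockMul f g) w := by
  have h : blockMul f (altSum g) = fun u => ∑ τ : Equiv.Perm (Fin l),
      (Equiv.Perm.sign τ : ℤ) * blockMul f g (u ∘ blockPerm 1 τ) := by
    funext u
    simp only [blockMul_comp_blockPerm]
    simp only [blockMul, altSum, Finset.mul_sum, Units.smul_def, zsmul_eq_mul, mul_left_comm]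
    rfl
  rw [h, altSum_fintypeSum]
  simp only [altSum_const_mul, altSum_comp_perm, sign_blockPerm, Equiv.Perm.sign_one, one_mul,
    Units.smul_def, zsmul_eq_mul]
  simp only [← mul_assoc, ← Int.cast_mul, ← Units.val_mul, Int.units_mul_self]
  simp [Fintype.card_perm]

theorem altSum_eq_zero_of_swap {N : ℕ} (f : (Fin N → V) → ℝ) {i j : Fin N} (hij : i ≠ j)
    (hf : ∀ u, f (u ∘ Equiv.swap i j) = f u) (w : Fin N → V) : altSum f w = 0 := by
  have h := altSum_comp_perm f (Equiv.swap i j) w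
  simp only [hf, Equiv.Perm.sign_swap hij, Units.smul_def] at h
  norm_num at h
  linarith

end AltSum

/-! ### The wedge product -/

section Wedge

variable {V : Type*} [AddCommGroup V] [Module ℝ V] [TopologicalSpace V]

theorem wedge_apply {k l : ℕ} (α : V [⋀^Fin k]→L[ℝ] ℝ) (β : V [⋀^Fin l]→L[ℝ] ℝ)
    (w : Fin (k + l) → V) :
    wedge α β w = ((k.factorial * l.factorial : ℝ)⁻¹) * altSum (blockMul α β) w := by
  rw [wedge, ContinuousAlternatingMap.smul_apply,
    ContinuousMultilinearMap.alternatization_apply_apply, smul_eq_mul]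
  rfl

theorem wedge_add_left {k l : ℕ} (α α' : V [⋀^Fin k]→L[ℝ] ℝ) (β : V [⋀^Fin l]→L[ℝ] ℝ) :
    wedge (α + α') β = wedge α β + wedge α' β := by
  ext w
  simp only [wedge_apply, ContinuousAlternatingMap.add_apply, altSum, blockMul, add_mul, smul_add,
    Finset.sum_add_distrib, mul_add]

theorem wedge_add_right {k l : ℕ} (α : V [⋀^Fin k]→L[ℝ] ℝ) (β β' : V [⋀^Fin l]→L[ℝ] ℝ) :
    wedge α (β + β') = wedge α β + wedge α β' := by
  ext w
  simp only [wedge_apply, ContinuousAlternatingMap.add_apply, altSum, blockMul, smul_add,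
    Finset.sum_add_distrib, mul_add]

theorem wedge_smul_left {k l : ℕ} (c : ℝ) (α : V [⋀^Fin k]→L[ℝ] ℝ) (β : V [⋀^Fin l]→L[ℝ] ℝ) :
    wedge (c • α) β = c • wedge α β := by
  ext w
  have h : blockMul (⇑(c • α)) β = fun u => c * blockMul α β u := by
    funext u; simp [blockMul, mul_assoc]
  rw [ContinuousAlternatingMap.smul_apply, wedge_apply, wedge_apply, h, altSum_const_mul,
    smul_eq_mul, mul_left_comm]

theorem wedge_smul_right {k l : ℕ} (c : ℝ) (α : V [⋀^Fin k]→L[ℝ] ℝ) (β : V [⋀^Fin l]→L[ℝ] ℝ) :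
    wedge α (c • β) = c • wedge α β := by
  ext w
  have h : blockMul α (⇑(c • β)) = fun u => c * blockMul α β u := by
    funext u; simp [blockMul, mul_left_comm]
  rw [ContinuousAlternatingMap.smul_apply, wedge_apply, wedge_apply, h, altSum_const_mul,
    smul_eq_mul, mul_left_comm]

theorem wedge_neg_left {k l : ℕ} (α : V [⋀^Fin k]→L[ℝ] ℝ) (β : V [⋀^Fin l]→L[ℝ] ℝ) :
    wedge (-α) β = -wedge α β := by
  ext w
  simp [wedge_apply, altSum, blockMul]

theorem wedge_neg_right {k l : ℕ} (α : V [⋀^Fin k]→L[ℝ] ℝ) (β : V [⋀^Fin l]→L[ℝ] ℝ) :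
    wedge α (-β) = -wedge α β := by
  ext w
  simp [wedge_apply, altSum, blockMul]

theorem wedge_zero_left {k l : ℕ} (β : V [⋀^Fin l]→L[ℝ] ℝ) :
    wedge (0 : V [⋀^Fin k]→L[ℝ] ℝ) β = 0 := by
  ext w
  simp [wedge_apply, altSum, blockMul]

theorem wedge_zero_right {k l : ℕ} (α : V [⋀^Fin k]→L[ℝ] ℝ) :
    wedge α (0 : V [⋀^Fin l]→L[ℝ] ℝ) = 0 := by
  ext w
  simp [wedge_apply, altSum, blockMul]

theorem wedge_comp {W : Type*} [AddCommGroup W] [Module ℝ W] [TopologicalSpace W] {k l : ℕ}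
    (α : V [⋀^Fin k]→L[ℝ] ℝ) (β : V [⋀^Fin l]→L[ℝ] ℝ) (g : W →L[ℝ] V) :
    (wedge α β).compContinuousLinearMap g =
      wedge (α.compContinuousLinearMap g) (β.compContinuousLinearMap g) := by
  ext w
  rw [ContinuousAlternatingMap.compContinuousLinearMap_apply, wedge_apply, wedge_apply]
  rfl

theorem wedgePow_comp {W : Type*} [AddCommGroup W] [Module ℝ W] [TopologicalSpace W]
    (β : V [⋀^Fin 2]→L[ℝ] ℝ) (g : W →L[ℝ] V) (m : ℕ) :
    (wedgePow β m).compContinuousLinearMap g = wedgePow (β.compContinuousLinearMap g) m := by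
  induction m with
  | zero => rfl
  | succ m ih =>
    change (wedge (wedgePow β m) β).compContinuousLinearMap g = _
    rw [wedge_comp, ih]
    rfl

/-- Associativity of the wedge product, in the degrees in which both sides have the same type. -/
theorem wedge_wedge_two {k l : ℕ} (α : V [⋀^Fin k]→L[ℝ] ℝ) (q : V [⋀^Fin l]→L[ℝ] ℝ)
    (β : V [⋀^Fin 2]→L[ℝ] ℝ) :
    (wedge α (wedge q β) : V [⋀^Fin (k + (l + 2))]→L[ℝ] ℝ) = wedge (wedge α q) β := by
  ext w
  have hl : blockMul α (wedge q β) = fun u => ((l.factorial * (2 : ℕ).factorial : ℝ)⁻¹) *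
      blockMul α (altSum (blockMul q β)) u := by
    funext u; simp only [blockMul, wedge_apply, mul_left_comm]
  have hr : blockMul (wedge α q) β = fun u => ((k.factorial * l.factorial : ℝ)⁻¹) *
      blockMul (altSum (blockMul α q)) β u := by
    funext u; simp only [blockMul, wedge_apply, mul_assoc]
  have hb : altSum (blockMul α (blockMul q β)) w = altSum (blockMul (blockMul α q) β) w := by
    have hf : (blockMul α (blockMul q β) : (Fin (k + (l + 2)) → V) → ℝ) =
        (blockMul (blockMul α q) β : (Fin (k + l + 2) → V) → ℝ) := by
      funext u
      have hj : (u ∘ Fin.natAdd k) ∘ Fin.natAdd l = u ∘ (Fin.natAdd (k + l) : Fin 2 → _) :=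
        funext fun j => congrArg u (Fin.ext (Nat.add_assoc k l j).symm)
      simp only [blockMul, mul_assoc, hj]
      rfl
    exact congrArg (fun f : (Fin (k + (l + 2)) → V) → ℝ => altSum f w) hf
  rw [wedge_apply, wedge_apply, hl, hr, altSum_const_mul, altSum_const_mul,
    altSum_blockMul_altSum_right, altSum_blockMul_altSum_left, hb]
  have h1 : ((k.factorial : ℕ) : ℝ) ≠ 0 := by positivity
  have h2 : ((l.factorial : ℕ) : ℝ) ≠ 0 := by positivity
  have h3 : (((k + l).factorial : ℕ) : ℝ) ≠ 0 := by positivity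
  have h4 : (((l + 2).factorial : ℕ) : ℝ) ≠ 0 := by positivity
  have h5 : (((2 : ℕ).factorial : ℕ) : ℝ) ≠ 0 := by positivity
  field_simp

theorem wedge_wedge_right_apply {k l m : ℕ} (p : V [⋀^Fin k]→L[ℝ] ℝ) (γ : V [⋀^Fin l]→L[ℝ] ℝ)
    (δ : V [⋀^Fin m]→L[ℝ] ℝ) (w : Fin (k + l + m) → V) :
    wedge (wedge p γ) δ w = ((k.factorial * l.factorial * m.factorial : ℝ)⁻¹) *
      altSum (blockMul (blockMul p γ) δ) w := by
  have hr : blockMul (wedge p γ) δ = fun u => ((k.factorial * l.factorial : ℝ)⁻¹) *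
      blockMul (altSum (blockMul p γ)) δ u := by
    funext u; simp only [blockMul, wedge_apply, mul_assoc]
  rw [wedge_apply, hr, altSum_const_mul, altSum_blockMul_altSum_left]
  have h1 : ((k.factorial : ℕ) : ℝ) ≠ 0 := by positivity
  have h2 : ((l.factorial : ℕ) : ℝ) ≠ 0 := by positivity
  have h3 : (((k + l).factorial : ℕ) : ℝ) ≠ 0 := by positivity
  have h4 : ((m.factorial : ℕ) : ℝ) ≠ 0 := by positivity
  field_simp

/-- Two-forms commute under the wedge product: exchanging two blocks of length two is an even
permutation of the arguments. -/
theorem wedge_wedge_two_comm {k : ℕ} (p : V [⋀^Fin k]→L[ℝ] ℝ) (γ δ : V [⋀^Fin 2]→L[ℝ] ℝ) :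
    wedge (wedge p γ) δ = wedge (wedge p δ) γ := by
  ext w
  rw [wedge_wedge_right_apply, wedge_wedge_right_apply]
  congr 1
  set e : Equiv.Perm (Fin (k + 2 + 2)) :=
    Equiv.swap (Fin.castAdd 2 (Fin.natAdd k 0)) (Fin.natAdd (k + 2) 0) *
      Equiv.swap (Fin.castAdd 2 (Fin.natAdd k 1)) (Fin.natAdd (k + 2) 1) with he
  have hsign : Equiv.Perm.sign e = 1 := by
    rw [he, Equiv.Perm.sign_mul, Equiv.Perm.sign_swap (castAdd_ne_natAdd _ _),
      Equiv.Perm.sign_swap (castAdd_ne_natAdd _ _)]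
    rfl
  have hf : blockMul (blockMul p γ) δ = fun u => blockMul (blockMul p δ) γ (u ∘ e) := by
    funext u
    have e1 (i : Fin k) : e (Fin.castAdd 2 (Fin.castAdd 2 i)) = Fin.castAdd 2 (Fin.castAdd 2 i) := by
      have hne (i : Fin k) (j : Fin 2) (a : Fin 2) : Fin.castAdd 2 (Fin.castAdd 2 i) ≠
          Fin.castAdd 2 (Fin.natAdd k j) := by
        simp [Fin.ext_iff]; omega
      rw [he, Equiv.Perm.mul_apply, Equiv.swap_apply_of_ne_of_ne (hne i 1 0)
        (castAdd_ne_natAdd _ _), Equiv.swap_apply_of_ne_of_ne (hne i 0 0) (castAdd_ne_natAdd _ _)]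
    have h01 : (Fin.castAdd 2 (Fin.natAdd k 0) : Fin (k + 2 + 2)) ≠
        Fin.castAdd 2 (Fin.natAdd k 1) := by simp [Fin.ext_iff]
    have h01' : Fin.natAdd (k + 2) (0 : Fin 2) ≠ Fin.natAdd (k + 2) 1 := by simp [Fin.ext_iff]
    have e2 (j : Fin 2) : e (Fin.castAdd 2 (Fin.natAdd k j)) = Fin.natAdd (k + 2) j := by
      rw [he, Equiv.Perm.mul_apply]
      fin_cases j
      · change Equiv.swap _ _ (Equiv.swap _ _ (Fin.castAdd 2 (Fin.natAdd k 0))) = _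
        rw [Equiv.swap_apply_of_ne_of_ne h01 (castAdd_ne_natAdd _ _), Equiv.swap_apply_left]
        rfl
      · change Equiv.swap _ _ (Equiv.swap _ _ (Fin.castAdd 2 (Fin.natAdd k 1))) = _
        rw [Equiv.swap_apply_left,
          Equiv.swap_apply_of_ne_of_ne (castAdd_ne_natAdd _ _).symm h01'.symm]
        rfl
    have e3 (j : Fin 2) : e (Fin.natAdd (k + 2) j) = Fin.castAdd 2 (Fin.natAdd k j) := by
      rw [he, Equiv.Perm.mul_apply]
      fin_cases j
      · change Equiv.swap _ _ (Equiv.swap _ _ (Fin.natAdd (k + 2) 0)) = _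
        rw [Equiv.swap_apply_of_ne_of_ne (castAdd_ne_natAdd _ _).symm h01', Equiv.swap_apply_right]
        rfl
      · change Equiv.swap _ _ (Equiv.swap _ _ (Fin.natAdd (k + 2) 1)) = _
        rw [Equiv.swap_apply_right,
          Equiv.swap_apply_of_ne_of_ne h01.symm (castAdd_ne_natAdd _ _)]
        rfl
    simp only [blockMul, Function.comp_def, e1, e2, e3]
    ring
  rw [hf, altSum_comp_perm, hsign, one_smul]

end Wedge

/-! ### The form `n α ∧ β ^ (n - 1) ∧ γ` -/

section Cross

variable {V : Type*} [AddCommGroup V] [Module ℝ V] [TopologicalSpace V]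

/-- `α ∧ q ∧ δ ∧ α = 0` for one-forms `α` and `δ`: exchanging the two arguments fed to `α`
changes the sign of the alternating sum but not its terms. -/
theorem wedge_wedge_wedge_self {l : ℕ} (α δ : V [⋀^Fin 1]→L[ℝ] ℝ) (q : V [⋀^Fin l]→L[ℝ] ℝ) :
    wedge (wedge α q) (wedge δ α) = 0 := by
  ext w
  have h1 : blockMul (wedge α q) (wedge δ α) = fun u =>
      ((Nat.factorial 1 * l.factorial : ℝ)⁻¹ * (Nat.factorial 1 * Nat.factorial 1 : ℝ)⁻¹) *
      blockMul (altSum (blockMul α q)) (altSum (blockMul δ α)) u := by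
    funext u; simp only [blockMul, wedge_apply]; ring
  have hne : (Fin.castAdd (1 + 1) (Fin.castAdd l 0) : Fin (1 + l + (1 + 1))) ≠
      Fin.natAdd (1 + l) (Fin.natAdd 1 0) := castAdd_ne_natAdd _ _
  rw [wedge_apply, h1, altSum_const_mul, altSum_blockMul_altSum_left, altSum_blockMul_altSum_right,
    altSum_eq_zero_of_swap _ hne]
  · simp
  intro u
  set s := Equiv.swap (Fin.castAdd (1 + 1) (Fin.castAdd l 0) : Fin (1 + l + (1 + 1)))
    (Fin.natAdd (1 + l) (Fin.natAdd 1 0)) with hs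
  have a1 : ((u ∘ s) ∘ Fin.castAdd (1 + 1)) ∘ Fin.castAdd l =
      (u ∘ Fin.natAdd (1 + l)) ∘ Fin.natAdd 1 := by
    funext i
    rw [Subsingleton.elim i 0]
    exact congrArg u (Equiv.swap_apply_left _ _)
  have a2 : ((u ∘ s) ∘ Fin.natAdd (1 + l)) ∘ Fin.natAdd 1 =
      (u ∘ Fin.castAdd (1 + 1)) ∘ Fin.castAdd l := by
    funext i
    rw [Subsingleton.elim i 0]
    exact congrArg u (Equiv.swap_apply_right _ _)
  have a3 : ((u ∘ s) ∘ Fin.castAdd (1 + 1)) ∘ Fin.natAdd 1 =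
      (u ∘ Fin.castAdd (1 + 1)) ∘ Fin.natAdd 1 := by
    funext i
    refine congrArg u (Equiv.swap_apply_of_ne_of_ne ?_ (castAdd_ne_natAdd _ _))
    exact fun h => castAdd_ne_natAdd (0 : Fin 1) i (Fin.castAdd_injective _ _ h).symm
  have a4 : ((u ∘ s) ∘ Fin.natAdd (1 + l)) ∘ Fin.castAdd 1 =
      (u ∘ Fin.natAdd (1 + l)) ∘ Fin.castAdd 1 := by
    funext i
    refine congrArg u (Equiv.swap_apply_of_ne_of_ne (castAdd_ne_natAdd _ _).symm ?_)
    exact fun h => castAdd_ne_natAdd i (0 : Fin 1) (Fin.natAdd_injective _ _ h)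
  simp only [blockMul, a1, a2, a3, a4]
  ring

theorem wedge_oneForm_oneForm_apply (δ α : V [⋀^Fin 1]→L[ℝ] ℝ) (v w : V) :
    (wedge δ α : V [⋀^Fin 2]→L[ℝ] ℝ) ![v, w] = δ ![v] * α ![w] - δ ![w] * α ![v] := by
  have h := wedge_apply δ α ![v, w]
  refine h.trans ?_
  have hu : (Finset.univ : Finset (Equiv.Perm (Fin (1 + 1)))) = {1, Equiv.swap 0 1} := by decide
  have hs : Equiv.Perm.sign (Equiv.swap (0 : Fin (1 + 1)) 1) = -1 := by decide
  rw [altSum, hu, Finset.sum_pair (by decide), hs, Equiv.Perm.sign_one]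
  have e1 : (![v, w] ∘ (1 : Equiv.Perm (Fin (1 + 1)))) ∘ Fin.castAdd 1 = ![v] := by
    funext i; fin_cases i; rfl
  have e2 : (![v, w] ∘ (1 : Equiv.Perm (Fin (1 + 1)))) ∘ Fin.natAdd 1 = ![w] := by
    funext i; fin_cases i; rfl
  have e3 : (![v, w] ∘ Equiv.swap (0 : Fin (1 + 1)) 1) ∘ Fin.castAdd 1 = ![w] := by
    funext i; fin_cases i; rfl
  have e4 : (![v, w] ∘ Equiv.swap (0 : Fin (1 + 1)) 1) ∘ Fin.natAdd 1 = ![v] := by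
    funext i; fin_cases i; rfl
  simp only [blockMul, e1, e2, e3, e4, Units.smul_def]
  simp
  ring

theorem wedge_wedgePow_succ (α : V [⋀^Fin 1]→L[ℝ] ℝ) (β : V [⋀^Fin 2]→L[ℝ] ℝ) (m : ℕ) :
    wedge α (wedgePow β (m + 1)) = wedge (wedge α (wedgePow β m)) β :=
  wedge_wedge_two α (wedgePow β m) β

theorem wedgeCross_add (α : V [⋀^Fin 1]→L[ℝ] ℝ) (β γ γ' : V [⋀^Fin 2]→L[ℝ] ℝ) (n : ℕ) :
    wedgeCross α β (γ + γ') n = wedgeCross α β γ n + wedgeCross α β γ' n := by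
  cases n with
  | zero => simp [wedgeCross]
  | succ m => simp only [wedgeCross, wedge_add_right, smul_add]

theorem wedgeCross_smul (α : V [⋀^Fin 1]→L[ℝ] ℝ) (β γ : V [⋀^Fin 2]→L[ℝ] ℝ) (c : ℝ) (n : ℕ) :
    wedgeCross α β (c • γ) n = c • wedgeCross α β γ n := by
  cases n with
  | zero => simp [wedgeCross]
  | succ m => simp only [wedgeCross, wedge_smul_right]; rw [smul_comm]

theorem wedgeCross_neg (α : V [⋀^Fin 1]→L[ℝ] ℝ) (β γ : V [⋀^Fin 2]→L[ℝ] ℝ) (n : ℕ) :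
    wedgeCross α β (-γ) n = -wedgeCross α β γ n := by
  cases n with
  | zero => simp [wedgeCross]
  | succ m => simp only [wedgeCross, wedge_neg_right, smul_neg]

theorem wedgeCross_self (α : V [⋀^Fin 1]→L[ℝ] ℝ) (β : V [⋀^Fin 2]→L[ℝ] ℝ) (n : ℕ) :
    wedgeCross α β β n = (n : ℝ) • wedge α (wedgePow β n) := by
  cases n with
  | zero => simp [wedgeCross]
  | succ m => rw [wedgeCross, wedge_wedgePow_succ]

theorem wedgeCross_wedge_self (α δ : V [⋀^Fin 1]→L[ℝ] ℝ) (β : V [⋀^Fin 2]→L[ℝ] ℝ) (n : ℕ) :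
    wedgeCross α β (wedge δ α) n = 0 := by
  cases n with
  | zero => rfl
  | succ m =>
    rw [wedgeCross]
    exact (congrArg _ (wedge_wedge_wedge_self α δ (wedgePow β m))).trans (smul_zero _)

theorem wedge_wedgeCross (α : V [⋀^Fin 1]→L[ℝ] ℝ) (β γ : V [⋀^Fin 2]→L[ℝ] ℝ) (n : ℕ) :
    wedge (wedgeCross α β γ n) β = (n : ℝ) • wedge (wedge α (wedgePow β n)) γ := by
  cases n with
  | zero =>
    rw [wedgeCross, Nat.cast_zero, zero_smul]
    exact wedge_zero_left β
  | succ m =>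
    rw [wedgeCross, wedge_smul_left, wedge_wedge_two_comm, wedge_wedgePow_succ]

end Cross

/-! ### Forms annihilated by a vector, and top-degree forms -/

section Annihilated

variable {V : Type*} [AddCommGroup V] [Module ℝ V] [TopologicalSpace V]

/-- The contraction `ι_v α` vanishes: `α` is zero as soon as one of its arguments is `v`. -/
def AnnihilatedBy {k : ℕ} (v : V) (α : V [⋀^Fin k]→L[ℝ] ℝ) : Prop :=
  ∀ (w : Fin k → V) (i : Fin k), w i = v → α w = 0

theorem AnnihilatedBy.wedge {k l : ℕ} {v : V} {α : V [⋀^Fin k]→L[ℝ] ℝ} {β : V [⋀^Fin l]→L[ℝ] ℝ}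
    (hα : AnnihilatedBy v α) (hβ : AnnihilatedBy v β) :
    AnnihilatedBy v (ContactNonholonomic.wedge α β) := by
  intro w i hi
  rw [wedge_apply, altSum, Finset.sum_eq_zero, mul_zero]
  intro σ _
  have hj : ∃ j, w (σ j) = v := ⟨σ.symm i, by simpa using hi⟩
  obtain ⟨j, hj⟩ := hj
  induction j using Fin.addCases with
  | left j => rw [blockMul, hα _ j hj, zero_mul, smul_zero]
  | right j => rw [blockMul, hβ _ j hj, mul_zero, smul_zero]

theorem AnnihilatedBy.wedgePow {v : V} {β : V [⋀^Fin 2]→L[ℝ] ℝ} (hβ : AnnihilatedBy v β) (m : ℕ) :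
    AnnihilatedBy v (wedgePow β m) := by
  induction m with
  | zero => exact fun w i => (Fin.elim0 i)
  | succ m ih => exact ih.wedge hβ

theorem annihilatedBy_one {v : V} {α : V [⋀^Fin 1]→L[ℝ] ℝ} (h : oneForm α v = 0) :
    AnnihilatedBy v α := by
  intro w i hi
  rw [← h]
  refine congrArg α (funext fun j => ?_)
  rw [Subsingleton.elim j i, hi]

theorem oneForm_apply (α : V [⋀^Fin 1]→L[ℝ] ℝ) (v : V) : oneForm α v = α ![v] :=
  congrArg α (funext fun i => by fin_cases i; rfl)

theorem oneForm_ext {α β : V [⋀^Fin 1]→L[ℝ] ℝ} (h : ∀ v, oneForm α v = oneForm β v) : α = β := by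
  ext w
  have hw : w = ![w 0] := by funext i; fin_cases i; rfl
  rw [hw, ← oneForm_apply, ← oneForm_apply, h]

theorem two_form_swap (β : V [⋀^Fin 2]→L[ℝ] ℝ) (v w : V) : β ![v, w] = -β ![w, v] := by
  have h := β.toAlternatingMap.map_swap ![w, v] (i := 0) (j := 1) (by decide)
  rw [← ContinuousAlternatingMap.coe_toAlternatingMap, ← h]
  congr 1
  funext i
  fin_cases i <;> simp

theorem two_form_self (β : V [⋀^Fin 2]→L[ℝ] ℝ) (v : V) : β ![v, v] = 0 :=
  β.map_eq_zero_of_eq ![v, v] (i := 0) (j := 1) rfl (by decide)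

theorem annihilatedBy_two {v : V} {β : V [⋀^Fin 2]→L[ℝ] ℝ} (h : ∀ w, β ![v, w] = 0) :
    AnnihilatedBy v β := by
  intro w i hi
  have hw : w = ![w 0, w 1] := by funext i; fin_cases i <;> rfl
  rw [hw]
  fin_cases i
  · change w 0 = v at hi
    rw [hi, h]
  · change w 1 = v at hi
    rw [two_form_swap, hi, h, neg_zero]

/-- A top-degree form annihilated by a non-zero vector `v` is zero: in any basis some basis vector
can be exchanged for `v`. -/
theorem AnnihilatedBy.eq_zero [FiniteDimensional ℝ V] {N : ℕ} (hN : Module.finrank ℝ V = N) {v : V}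
    (hv : v ≠ 0) {α : V [⋀^Fin N]→L[ℝ] ℝ} (h : AnnihilatedBy v α) : α = 0 := by
  ext w
  by_cases hw : LinearIndependent ℝ w
  · let b := basisOfLinearIndependentOfCardEqFinrank' w hw (by simp [hN])
    have hb : ⇑b = w := coe_basisOfLinearIndependentOfCardEqFinrank' _ _ _
    obtain ⟨i, hi⟩ : ∃ i, b.repr v i ≠ 0 := by
      by_contra! hcon
      exact hv (b.repr.map_eq_zero_iff.1 (Finsupp.ext hcon))
    have hsum : v = ∑ j, b.repr v j • w j := by
      conv_lhs => rw [← b.sum_repr v, hb]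
    have h0 : α (Function.update w i v) = 0 := h _ i (by simp)
    rw [hsum, ← ContinuousAlternatingMap.coe_toAlternatingMap, AlternatingMap.map_update_sum,
      Finset.sum_eq_single i] at h0
    · rw [AlternatingMap.map_update_smul, Function.update_eq_self, smul_eq_zero] at h0
      exact h0.resolve_left hi
    · intro j _ hj
      rw [AlternatingMap.map_update_smul]
      rw [AlternatingMap.map_update_self _ _ hj.symm, smul_zero]
    · simp
  · exact α.toAlternatingMap.map_linearDependent w hw

/-- A two-form on an odd-dimensional space is degenerate. -/
theorem exists_two_form_kernel [FiniteDimensional ℝ V] {n : ℕ}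
    (hn : Module.finrank ℝ V = 2 * n + 1) (β : V [⋀^Fin 2]→L[ℝ] ℝ) :
    ∃ r : V, r ≠ 0 ∧ ∀ w, β ![r, w] = 0 := by
  -- the matrix `A` of `β` is antisymmetric of odd size, so that `det A = -det A`
  let b := Module.finBasisOfFinrankEq ℝ V hn
  let A : Matrix (Fin (2 * n + 1)) (Fin (2 * n + 1)) ℝ := Matrix.of fun i j => β ![b i, b j]
  have hA : A.transpose = -A := by
    ext i j
    exact two_form_swap β (b j) (b i)
  have hdet : A.det = 0 := by
    have h1 : A.det = (-1) ^ (2 * n + 1) * A.det := by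
      conv_lhs => rw [← Matrix.det_transpose, hA, Matrix.det_neg, Fintype.card_fin]
    rw [Odd.neg_one_pow ⟨n, rfl⟩] at h1
    linarith
  obtain ⟨c, hc, hAc⟩ := Matrix.exists_mulVec_eq_zero_iff.2 hdet
  let B : V →ₗ[ℝ] Module.Dual ℝ V := flatMap 0 β
  have hB (v w : V) : B v w = β ![v, w] := by
    change β ![v, w] + oneForm 0 v * oneForm 0 w = _
    rw [oneForm_apply]
    simp
  refine ⟨∑ j, c j • b j, ?_, fun w => ?_⟩
  · intro h0
    apply hc
    funext j
    exact Fintype.linearIndependent_iff.1 b.linearIndependent c h0 j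
  · rw [← hB]
    suffices hz : B (∑ j, c j • b j) = 0 by rw [hz]; rfl
    refine b.ext fun i => ?_
    have hi := congrFun hAc i
    simp only [Matrix.mulVec, dotProduct, A, Matrix.of_apply, Pi.zero_apply] at hi
    simp only [map_sum, map_smul, LinearMap.sum_apply, LinearMap.smul_apply, hB, smul_eq_mul,
      LinearMap.zero_apply]
    rw [← neg_eq_zero, ← Finset.sum_neg_distrib, ← hi]
    refine Finset.sum_congr rfl fun j _ => ?_
    rw [two_form_swap β (b j)]
    ring

/-- `ι_z β ∧ β ^ n = 0` on a space of dimension `2n + 1`: the left-hand side is a top-degree form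
annihilated by any vector in the kernel of `β`. -/
theorem wedge_wedgePow_eq_zero_of_contraction [FiniteDimensional ℝ V] {n : ℕ}
    (hn : Module.finrank ℝ V = 2 * n + 1) (β : V [⋀^Fin 2]→L[ℝ] ℝ) (α : V [⋀^Fin 1]→L[ℝ] ℝ) (z : V)
    (hα : ∀ v, oneForm α v = β ![z, v]) : wedge α (wedgePow β n) = 0 := by
  obtain ⟨r, hr, hβ⟩ := exists_two_form_kernel hn β
  refine AnnihilatedBy.eq_zero (by rw [hn, add_comm]) hr (AnnihilatedBy.wedge ?_ ?_)
  · exact annihilatedBy_one (by rw [hα, two_form_swap, hβ, neg_zero])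
  · exact (annihilatedBy_two hβ).wedgePow n

end Annihilated

/-! ### Bijectivity of `♭` on a vector space -/

section Flat

variable {V : Type*} [AddCommGroup V] [Module ℝ V] [TopologicalSpace V]

/-- If `♭(v) = 0`, then evaluating at `v` gives `α(v) = 0`, hence `ι_v β = 0`, so that `v` annihilates
the top-degree form `α ∧ β ^ n`. -/
theorem flatMap_injective [FiniteDimensional ℝ V] {n : ℕ} (hn : Module.finrank ℝ V = 2 * n + 1)
    {α : V [⋀^Fin 1]→L[ℝ] ℝ} {β : V [⋀^Fin 2]→L[ℝ] ℝ} (h : wedge α (wedgePow β n) ≠ 0) :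
    Function.Injective (flatMap α β) := by
  rw [injective_iff_map_eq_zero]
  intro v hv
  by_contra hv0
  have h1 (w : V) : β ![v, w] + oneForm α v * oneForm α w = 0 := LinearMap.congr_fun hv w
  have hα : oneForm α v = 0 := by
    have := h1 v
    rw [two_form_self, zero_add] at this
    exact mul_self_eq_zero.1 this
  refine h (AnnihilatedBy.eq_zero (by rw [hn, add_comm]) hv0
    ((annihilatedBy_one hα).wedge ((annihilatedBy_two fun w => ?_).wedgePow n)))
  simpa [hα] using h1 w

theorem flatMap_bijective [FiniteDimensional ℝ V] {n : ℕ} (hn : Module.finrank ℝ V = 2 * n + 1)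
    {α : V [⋀^Fin 1]→L[ℝ] ℝ} {β : V [⋀^Fin 2]→L[ℝ] ℝ} (h : wedge α (wedgePow β n) ≠ 0) :
    Function.Bijective (flatMap α β) := by
  have hi := flatMap_injective hn h
  exact ⟨hi, (LinearMap.injective_iff_surjective_of_finrank_eq_finrank
    (Subspace.dual_finrank_eq (K := ℝ) (V := V)).symm).1 hi⟩

end Flat

/-! ### Lie derivatives of forms on a vector space -/

section Calculus

variable {E : Type*} [NormedAddCommGroup E] [NormedSpace ℝ E]

theorem finiteDimensional_forms [FiniteDimensional ℝ E] (k : ℕ) :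
    FiniteDimensional ℝ (E [⋀^Fin k]→L[ℝ] ℝ) := by
  let f : (E [⋀^Fin k]→L[ℝ] ℝ) →ₗ[ℝ] MultilinearMap ℝ (fun _ : Fin k => E) ℝ :=
    { toFun := fun α => α.toAlternatingMap.toMultilinearMap
      map_add' := fun _ _ => rfl
      map_smul' := fun _ _ => rfl }
  refine Module.Finite.of_injective f fun α β h => ?_
  ext w
  exact congrArg (fun g : MultilinearMap ℝ (fun _ : Fin k => E) ℝ => g w) h

/-- In finite dimension the wedge product is a continuous bilinear map, so that it can be
differentiated by the product rule. -/
theorem exists_wedge_clm [FiniteDimensional ℝ E] (k l : ℕ) :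
    ∃ B : (E [⋀^Fin k]→L[ℝ] ℝ) →L[ℝ] (E [⋀^Fin l]→L[ℝ] ℝ) →L[ℝ] (E [⋀^Fin (k + l)]→L[ℝ] ℝ),
      ∀ α β, B α β = wedge α β := by
  have := finiteDimensional_forms (E := E) k
  have := finiteDimensional_forms (E := E) l
  exact ⟨(LinearMap.mk₂ ℝ wedge wedge_add_left wedge_smul_left wedge_add_right
    wedge_smul_right).toContinuousBilinearMap, fun _ _ => rfl⟩

theorem fderiv_wedge [FiniteDimensional ℝ E] {F : Type*} [NormedAddCommGroup F]
    [NormedSpace ℝ F] {k l : ℕ}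
    {α : F → E [⋀^Fin k]→L[ℝ] ℝ} {β : F → E [⋀^Fin l]→L[ℝ] ℝ} {y : F}
    (hα : DifferentiableAt ℝ α y) (hβ : DifferentiableAt ℝ β y) :
    DifferentiableAt ℝ (fun z => wedge (α z) (β z)) y ∧
    ∀ u, fderiv ℝ (fun z => wedge (α z) (β z)) y u =
      wedge (fderiv ℝ α y u) (β y) + wedge (α y) (fderiv ℝ β y u) := by
  obtain ⟨B, hB⟩ := exists_wedge_clm (E := E) k l
  have h := B.hasFDerivAt_of_bilinear hα.hasFDerivAt hβ.hasFDerivAt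
  simp only [hB] at h
  refine ⟨h.differentiableAt, fun u => ?_⟩
  rw [h.fderiv]
  simp [hB, add_comm]

/-- Differentiating the compatibility of the wedge product with pullbacks along `g` at the
identity shows that an endomorphism acts on forms by a derivation. -/
theorem fderivComp_wedge [FiniteDimensional ℝ E] {k l : ℕ} (α : E [⋀^Fin k]→L[ℝ] ℝ)
    (β : E [⋀^Fin l]→L[ℝ] ℝ) (A : E →L[ℝ] E) :
    (wedge α β).fderivCompContinuousLinearMap (ContinuousLinearMap.id ℝ E) A =
      wedge (α.fderivCompContinuousLinearMap (ContinuousLinearMap.id ℝ E) A) β +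
        wedge α (β.fderivCompContinuousLinearMap (ContinuousLinearMap.id ℝ E) A) := by
  have key {m : ℕ} (γ : E [⋀^Fin m]→L[ℝ] ℝ) :
      HasFDerivAt (fun g : E →L[ℝ] E => γ.compContinuousLinearMap g)
        (γ.fderivCompContinuousLinearMap (ContinuousLinearMap.id ℝ E))
        (ContinuousLinearMap.id ℝ E) := by
    have h := HasFDerivAt.continuousAlternatingMapCompContinuousLinearMap
      (g := fun g : E →L[ℝ] E => g) (hasFDerivAt_const γ (ContinuousLinearMap.id ℝ E))
      (hasFDerivAt_id (𝕜 := ℝ) _)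
    refine h.congr_fderiv ?_
    rw [ContinuousLinearMap.comp_zero, zero_add, ContinuousLinearMap.comp_id]
  have h1 := (fderiv_wedge (key α).differentiableAt (key β).differentiableAt).2 A
  rw [(key α).fderiv, (key β).fderiv] at h1
  simp only [← wedge_comp] at h1
  rw [(key (wedge α β)).fderiv] at h1
  exact h1

theorem lieDerivForm_wedge [FiniteDimensional ℝ E] {k l : ℕ} (X : E → E)
    {α : E → E [⋀^Fin k]→L[ℝ] ℝ} {β : E → E [⋀^Fin l]→L[ℝ] ℝ} {y : E}
    (hα : DifferentiableAt ℝ α y) (hβ : DifferentiableAt ℝ β y) :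
    lieDerivForm X (fun z => wedge (α z) (β z)) y =
      wedge (lieDerivForm X α y) (β y) + wedge (α y) (lieDerivForm X β y) := by
  simp only [lieDerivForm, (fderiv_wedge hα hβ).2, fderivComp_wedge, wedge_add_left,
    wedge_add_right]
  abel

theorem differentiableAt_wedgePow [FiniteDimensional ℝ E] {F : Type*} [NormedAddCommGroup F]
    [NormedSpace ℝ F] {β : F → E [⋀^Fin 2]→L[ℝ] ℝ} {y : F}
    (hβ : DifferentiableAt ℝ β y) (n : ℕ) : DifferentiableAt ℝ (fun z => wedgePow (β z) n) y := by
  induction n with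
  | zero => exact differentiableAt_const _
  | succ n ih => exact (fderiv_wedge ih hβ).1

theorem lieDerivForm_const_zero_form (X : E → E) (c : E [⋀^Fin 0]→L[ℝ] ℝ) (y : E) :
    lieDerivForm X (fun _ => c) y = 0 := by
  ext w
  simp [lieDerivForm]

/-- Leibniz rule for the Lie derivative of `α ∧ β ^ n`, with `α` a one-form, `β` a two-form. -/
theorem lieDerivForm_wedge_wedgePow [FiniteDimensional ℝ E] (X : E → E)
    {α : E → E [⋀^Fin 1]→L[ℝ] ℝ} {β : E → E [⋀^Fin 2]→L[ℝ] ℝ} {y : E}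
    (hα : DifferentiableAt ℝ α y) (hβ : DifferentiableAt ℝ β y) (n : ℕ) :
    lieDerivForm X (fun z => wedge (α z) (wedgePow (β z) n)) y =
      wedge (lieDerivForm X α y) (wedgePow (β y) n) +
        wedgeCross (α y) (β y) (lieDerivForm X β y) n := by
  induction n with
  | zero =>
    rw [lieDerivForm_wedge X hα (differentiableAt_wedgePow hβ 0)]
    congr 1
    have h : lieDerivForm X (fun z => wedgePow (β z) 0) y = 0 :=
      lieDerivForm_const_zero_form X _ y
    rw [h]
    exact wedge_zero_right _
  | succ n ih =>
    have h1 : (fun z => wedge (α z) (wedgePow (β z) (n + 1))) =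
        fun z => wedge (wedge (α z) (wedgePow (β z) n)) (β z) :=
      funext fun z => wedge_wedgePow_succ _ _ _
    rw [h1, wedge_wedgePow_succ]
    refine (lieDerivForm_wedge X (fderiv_wedge hα (differentiableAt_wedgePow hβ n)).1
      hβ).trans ?_
    have aux {N : ℕ} (p q : E [⋀^Fin N]→L[ℝ] ℝ) :
        p + (n : ℝ) • q + q = p + ((n + 1 : ℕ) : ℝ) • q := by
      push_cast
      module
    rw [ih, wedge_add_left, wedge_wedgeCross, wedgeCross]
    exact aux _ _

theorem fderivComp_oneForm (α : E [⋀^Fin 1]→L[ℝ] ℝ) (g A : E →L[ℝ] E) (v : E) :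
    α.fderivCompContinuousLinearMap g A ![v] = α ![A v] := by
  rw [ContinuousAlternatingMap.fderivCompContinuousLinearMap_apply]
  simp only [Finset.univ_unique, Finset.sum_singleton]
  refine congrArg α (funext fun i => ?_)
  fin_cases i
  simp

theorem fderivComp_twoForm (β : E [⋀^Fin 2]→L[ℝ] ℝ) (A : E →L[ℝ] E) (v w : E) :
    β.fderivCompContinuousLinearMap (ContinuousLinearMap.id ℝ E) A ![v, w] =
      β ![A v, w] + β ![v, A w] := by
  rw [ContinuousAlternatingMap.fderivCompContinuousLinearMap_apply, Fin.sum_univ_two]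
  congr 2
  · funext i; fin_cases i <;> simp
  · funext i; fin_cases i <;> simp

theorem alternatize_one_apply (f : E →L[ℝ] E [⋀^Fin 1]→L[ℝ] ℝ) (v w : E) :
    ContinuousAlternatingMap.alternatizeUncurryFin f ![v, w] = f v ![w] - f w ![v] := by
  rw [ContinuousAlternatingMap.alternatizeUncurryFin_apply, Fin.sum_univ_two]
  have h0 : Fin.removeNth (0 : Fin 2) ![v, w] = ![w] := by
    funext i; fin_cases i; rfl
  have h1 : Fin.removeNth (1 : Fin 2) ![v, w] = ![v] := by
    funext i; fin_cases i; rfl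
  simp only [h0, h1]
  simp [sub_eq_add_neg]

theorem extDeriv_one_apply (θ : E → E [⋀^Fin 1]→L[ℝ] ℝ) (y v w : E) :
    extDeriv θ y ![v, w] = fderiv ℝ θ y v ![w] - fderiv ℝ θ y w ![v] :=
  alternatize_one_apply _ _ _

theorem two_form_ext {β γ : E [⋀^Fin 2]→L[ℝ] ℝ} (h : ∀ v w, β ![v, w] = γ ![v, w]) : β = γ := by
  ext w
  have hw : w = ![w 0, w 1] := by funext i; fin_cases i <;> rfl
  rw [hw, h]

theorem lieDerivForm_one_apply (X : E → E) (θ : E → E [⋀^Fin 1]→L[ℝ] ℝ) (y v : E) :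
    lieDerivForm X θ y ![v] = fderiv ℝ θ y (X y) ![v] + θ y ![fderiv ℝ X y v] := by
  rw [lieDerivForm, ContinuousAlternatingMap.add_apply, fderivComp_oneForm]

theorem fderiv_lieDerivForm_apply {k : ℕ} {X : E → E} {θ : E → E [⋀^Fin k]→L[ℝ] ℝ} {y : E}
    (hX : ContDiffAt ℝ 2 X y) (hθ : ContDiffAt ℝ 2 θ y) :
    ∀ u, fderiv ℝ (lieDerivForm X θ) y u =
      fderiv ℝ (fderiv ℝ θ) y u (X y) + fderiv ℝ θ y (fderiv ℝ X y u) +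
      ((fderiv ℝ θ y u).fderivCompContinuousLinearMap (ContinuousLinearMap.id ℝ E) (fderiv ℝ X y) +
      (θ y).fderivCompContinuousLinearMap (ContinuousLinearMap.id ℝ E)
        (fderiv ℝ (fderiv ℝ X) y u)) := by
  intro u
  have h1 : DifferentiableAt ℝ X y := hX.differentiableAt (by norm_num)
  have h2 : DifferentiableAt ℝ θ y := hθ.differentiableAt (by norm_num)
  have h3 : DifferentiableAt ℝ (fderiv ℝ X) y :=
    (hX.fderiv_right (m := 1) (by norm_num)).differentiableAt (by norm_num)
  have h4 : DifferentiableAt ℝ (fderiv ℝ θ) y :=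
    (hθ.fderiv_right (m := 1) (by norm_num)).differentiableAt (by norm_num)
  have ha := h4.hasFDerivAt.clm_apply h1.hasFDerivAt
  have hb := (ContinuousAlternatingMap.fderivCompContinuousLinearMapCLM (ι := Fin k) ℝ
    (ContinuousLinearMap.id ℝ E)).hasFDerivAt_of_bilinear h2.hasFDerivAt h3.hasFDerivAt
  have hab := ha.add hb
  have : fderiv ℝ (lieDerivForm X θ) y = _ := hab.fderiv
  have hu : fderiv ℝ (lieDerivForm X θ) y u =
      fderiv ℝ θ y (fderiv ℝ X y u) + fderiv ℝ (fderiv ℝ θ) y u (X y) +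
      ((θ y).fderivCompContinuousLinearMap (ContinuousLinearMap.id ℝ E)
        (fderiv ℝ (fderiv ℝ X) y u) +
      (fderiv ℝ θ y u).fderivCompContinuousLinearMap (ContinuousLinearMap.id ℝ E)
        (fderiv ℝ X y)) := by
    rw [this]
    rfl
  rw [hu]
  abel

/-- On one-forms, the Lie derivative commutes with the exterior derivative. -/
theorem lieDerivForm_extDeriv {X : E → E} {θ : E → E [⋀^Fin 1]→L[ℝ] ℝ} {y : E}
    (hX : ContDiffAt ℝ 2 X y) (hθ : ContDiffAt ℝ 2 θ y) :
    lieDerivForm X (extDeriv θ) y = extDeriv (lieDerivForm X θ) y := by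
  have h4 : DifferentiableAt ℝ (fderiv ℝ θ) y :=
    (hθ.fderiv_right (m := 1) (by norm_num)).differentiableAt (by norm_num)
  have hd : fderiv ℝ (extDeriv θ) y = _ :=
    ((ContinuousAlternatingMap.alternatizeUncurryFinCLM ℝ E ℝ).hasFDerivAt.comp y
      h4.hasFDerivAt).fderiv
  have hsθ := (hθ.isSymmSndFDerivAt (by simp)).eq
  have hsX := (hX.isSymmSndFDerivAt (by simp)).eq
  refine two_form_ext fun v w => ?_
  have h5 : (extDeriv θ y).fderivCompContinuousLinearMap (ContinuousLinearMap.id ℝ E)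
      (fderiv ℝ X y) ![v, w] = _ := fderivComp_twoForm (extDeriv θ y) (fderiv ℝ X y) v w
  rw [extDeriv_one_apply, fderiv_lieDerivForm_apply hX hθ, fderiv_lieDerivForm_apply hX hθ,
    lieDerivForm, hd]
  simp only [ContinuousAlternatingMap.add_apply, fderivComp_oneForm, h5,
    ContinuousLinearMap.comp_apply, ContinuousAlternatingMap.alternatizeUncurryFinCLM_apply,
    alternatize_one_apply, extDeriv_one_apply]
  rw [hsθ (X y) v, hsθ (X y) w, hsX w v]
  ring

/-- Cartan's formula for one-forms, `L_X θ = ι_X dθ + d(θ(X))`. -/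
theorem lieDerivForm_one_eq_cartan {X : E → E} {θ : E → E [⋀^Fin 1]→L[ℝ] ℝ} {y : E}
    (hX : DifferentiableAt ℝ X y) (hθ : DifferentiableAt ℝ θ y) (v : E) :
    lieDerivForm X θ y ![v] =
      extDeriv θ y ![X y, v] + fderiv ℝ (fun z => θ z ![X z]) y v := by
  have h : fderiv ℝ (fun z => θ z ![X z]) y v =
      fderiv ℝ θ y v ![X y] + θ y ![fderiv ℝ X y v] := by
    have h0 (z : E) : (![X z] : Fin 1 → E) = fun _ => X z := by
      funext i; fin_cases i; rfl
    simp only [h0]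
    rw [(hθ.hasFDerivAt.continuousAlternatingMap_apply (g := fun _ => X)
      fun _ => hX.hasFDerivAt).fderiv]
    simp only [add_apply, Finset.univ_unique, Finset.sum_singleton, ContinuousLinearMap.comp_apply]
    refine congrArg _ (congrArg (θ y) (funext fun i => ?_))
    fin_cases i
    simp
  rw [h, lieDerivForm_one_apply, extDeriv_one_apply]
  ring

/-- Naturality of the Lie derivative under pullback by a map `φ` which relates `X'` to `X`. The second
derivatives of `φ` cancel by their symmetry. -/
theorem lieDerivForm_pullback {k : ℕ} {X X' : E → E} {θ : E → E [⋀^Fin k]→L[ℝ] ℝ} {φ : E → E}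
    {y : E} (hφ : ContDiffAt ℝ 2 φ y) (hX : DifferentiableAt ℝ X (φ y))
    (hX' : DifferentiableAt ℝ X' y) (hθ : DifferentiableAt ℝ θ (φ y))
    (hrel : ∀ᶠ z in 𝓝 y, fderiv ℝ φ z (X' z) = X (φ z)) :
    lieDerivForm X' (fun z => (θ (φ z)).compContinuousLinearMap (fderiv ℝ φ z)) y =
      (lieDerivForm X θ (φ y)).compContinuousLinearMap (fderiv ℝ φ y) := by
  have hφ1 : DifferentiableAt ℝ φ y := hφ.differentiableAt (by norm_num)
  have hφ2 : DifferentiableAt ℝ (fderiv ℝ φ) y :=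
    (hφ.fderiv_right (m := 1) (by norm_num)).differentiableAt (by norm_num)
  have hc := (hθ.hasFDerivAt.comp y hφ1.hasFDerivAt
    ).continuousAlternatingMapCompContinuousLinearMap hφ2.hasFDerivAt
  -- the derivative of the relation `Dφ(X') = X ∘ φ`
  have hr : (fderiv ℝ φ y).comp (fderiv ℝ X' y) + (fderiv ℝ (fderiv ℝ φ) y).flip (X' y) =
      (fderiv ℝ X (φ y)).comp (fderiv ℝ φ y) := by
    have h1 := (hφ2.hasFDerivAt.clm_apply hX'.hasFDerivAt).fderiv
    have h2 := (hX.hasFDerivAt.comp y hφ1.hasFDerivAt).fderiv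
    rw [← h1, ← h2]
    exact Filter.EventuallyEq.fderiv_eq hrel
  have hsym : (fderiv ℝ (fderiv ℝ φ) y).flip (X' y) = fderiv ℝ (fderiv ℝ φ) y (X' y) := by
    ext v
    exact (hφ.isSymmSndFDerivAt (by simp)).eq v (X' y)
  have e1 (A : E →L[ℝ] E) : ((θ (φ y)).compContinuousLinearMap (fderiv ℝ φ y)
      ).fderivCompContinuousLinearMap (ContinuousLinearMap.id ℝ E) A =
      (θ (φ y)).fderivCompContinuousLinearMap (fderiv ℝ φ y) ((fderiv ℝ φ y).comp A) := by
    ext w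
    simp only [ContinuousAlternatingMap.fderivCompContinuousLinearMap_apply,
      ContinuousAlternatingMap.compContinuousLinearMap_apply]
    refine Finset.sum_congr rfl fun i _ => congrArg _ (funext fun j => ?_)
    by_cases h : j = i <;> simp [Function.update_apply, h]
  have e2 (A : E →L[ℝ] E) : ((θ (φ y)).fderivCompContinuousLinearMap (ContinuousLinearMap.id ℝ E)
      A).compContinuousLinearMap (fderiv ℝ φ y) =
      (θ (φ y)).fderivCompContinuousLinearMap (fderiv ℝ φ y) (A.comp (fderiv ℝ φ y)) := by
    ext w
    simp only [ContinuousAlternatingMap.fderivCompContinuousLinearMap_apply,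
      ContinuousAlternatingMap.compContinuousLinearMap_apply]
    refine Finset.sum_congr rfl fun i _ => congrArg _ (funext fun j => ?_)
    by_cases h : j = i <;> simp [h]
  have hL : lieDerivForm X θ (φ y) = fderiv ℝ θ (φ y) (X (φ y)) +
      (θ (φ y)).fderivCompContinuousLinearMap (ContinuousLinearMap.id ℝ E)
        (fderiv ℝ X (φ y)) := rfl
  have hadd (α β : E [⋀^Fin k]→L[ℝ] ℝ) (g : E →L[ℝ] E) : (α + β).compContinuousLinearMap g =
      α.compContinuousLinearMap g + β.compContinuousLinearMap g := rfl
  have hfd : fderiv ℝ (fun z => (θ (φ z)).compContinuousLinearMap (fderiv ℝ φ z)) y = _ :=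
    hc.fderiv
  rw [hL, hadd, e2, ← hr, map_add, ← e1, hsym, lieDerivForm, hfd, ← hrel.self_of_nhds]
  simp only [add_apply, ContinuousLinearMap.comp_apply, Function.comp_apply,
    ContinuousAlternatingMap.compContinuousLinearMapCLM_apply]
  abel

theorem lieDerivForm_congr {k : ℕ} {X X' : E → E} {θ θ' : E → E [⋀^Fin k]→L[ℝ] ℝ} {y : E}
    (hX : X =ᶠ[𝓝 y] X') (hθ : θ =ᶠ[𝓝 y] θ') : lieDerivForm X θ y = lieDerivForm X' θ' y := by
  simp only [lieDerivForm, hX.fderiv_eq, hθ.fderiv_eq, hX.eq_of_nhds, hθ.eq_of_nhds]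

theorem lieDerivForm_add_field {k : ℕ} {X X' : E → E} {θ : E → E [⋀^Fin k]→L[ℝ] ℝ} {y : E}
    (hX : DifferentiableAt ℝ X y) (hX' : DifferentiableAt ℝ X' y) :
    lieDerivForm (fun z => X z + X' z) θ y = lieDerivForm X θ y + lieDerivForm X' θ y := by
  simp only [lieDerivForm, fderiv_fun_add hX hX', map_add]
  abel

/-- The differential `Df` of a function as a form of degree one. -/
noncomputable def diffForm (f : E → ℝ) (y : E) : E [⋀^Fin 1]→L[ℝ] ℝ :=
  ContinuousAlternatingMap.ofSubsingleton ℝ E ℝ (0 : Fin 1) (fderiv ℝ f y)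

theorem diffForm_apply (f : E → ℝ) (y v : E) : diffForm f y ![v] = fderiv ℝ f y v := rfl

theorem lieDerivForm_smul {k : ℕ} {X : E → E} {f : E → ℝ} {θ : E → E [⋀^Fin k]→L[ℝ] ℝ} {y : E}
    (hf : DifferentiableAt ℝ f y) (hθ : DifferentiableAt ℝ θ y) :
    lieDerivForm X (fun z => f z • θ z) y =
      f y • lieDerivForm X θ y + fderiv ℝ f y (X y) • θ y := by
  have h : (f y • θ y).fderivCompContinuousLinearMap (ContinuousLinearMap.id ℝ E) (fderiv ℝ X y) =
      f y • (θ y).fderivCompContinuousLinearMap (ContinuousLinearMap.id ℝ E) (fderiv ℝ X y) := by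
    ext w
    simp [Finset.mul_sum]
  rw [lieDerivForm, h, fderiv_fun_smul hf hθ, lieDerivForm, smul_add]
  simp only [add_apply, smul_apply, ContinuousLinearMap.smulRight_apply]
  abel

/-- `d(f θ) = df ∧ θ + f dθ` for a one-form `θ`. -/
theorem extDeriv_smul_one {f : E → ℝ} {θ : E → E [⋀^Fin 1]→L[ℝ] ℝ} {y : E}
    (hf : DifferentiableAt ℝ f y) (hθ : DifferentiableAt ℝ θ y) :
    extDeriv (fun z => f z • θ z) y = wedge (diffForm f y) (θ y) + f y • extDeriv θ y := by
  refine two_form_ext fun v w => ?_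
  rw [extDeriv_one_apply, fderiv_fun_smul hf hθ, ContinuousAlternatingMap.add_apply,
    ContinuousAlternatingMap.smul_apply, extDeriv_one_apply]
  refine Eq.trans ?_ (congrArg (· + _) (wedge_oneForm_oneForm_apply _ _ _ _).symm)
  simp [diffForm_apply]
  ring

end Calculus

/-! ### Forms and vector fields in charts -/

section Charts

variable {E : Type*} [NormedAddCommGroup E] [NormedSpace ℝ E]
  {P : Type*} [TopologicalSpace P] [ChartedSpace E P]

/-- The change of coordinates from the preferred chart at `a` to the one at `b`. -/
noncomputable def transition (a b : P) : E → E :=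
  extChartAt 𝓘(ℝ, E) b ∘ (extChartAt 𝓘(ℝ, E) a).symm

/-- The derivative at `y` of the inverse of the preferred chart at `x₀`, where the tangent spaces
of `P` are identified with the model space `E`. -/
noncomputable def chartMap (x₀ : P) (y : E) : E →L[ℝ] E :=
  mfderiv 𝓘(ℝ, E) 𝓘(ℝ, E) (extChartAt 𝓘(ℝ, E) x₀).symm y

/-- A form on `P`, with the tangent spaces of `P` identified with the model space. -/
def rawForm {k : ℕ} (θ : DForm E P k) (p : P) : E [⋀^Fin k]→L[ℝ] ℝ := θ p

/-- A vector field on `P`, with the tangent spaces of `P` identified with the model space. -/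
def rawField (X : VField E P) (p : P) : E := X p

theorem chartForm_eq {k : ℕ} (x₀ : P) (θ : DForm E P k) (y : E) :
    chartForm x₀ θ y = (rawForm θ ((extChartAt 𝓘(ℝ, E) x₀).symm y)).compContinuousLinearMap
      (chartMap x₀ y) := rfl

theorem chartVField_eq (x₀ : P) (X : VField E P) (y : E) :
    chartVField x₀ X y =
      (chartMap x₀ y).inverse (rawField X ((extChartAt 𝓘(ℝ, E) x₀).symm y)) := rfl

theorem eventually_mem_target {a : P} {y : E} (hy : y ∈ (extChartAt 𝓘(ℝ, E) a).target) :
    ∀ᶠ z in 𝓝 y, z ∈ (extChartAt 𝓘(ℝ, E) a).target :=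
  (isOpen_extChartAt_target a).mem_nhds hy

theorem eventually_symm_mem {a : P} {y : E} (hy : y ∈ (extChartAt 𝓘(ℝ, E) a).target)
    {U : Set P} (hU : U ∈ 𝓝 ((extChartAt 𝓘(ℝ, E) a).symm y)) :
    ∀ᶠ z in 𝓝 y, (extChartAt 𝓘(ℝ, E) a).symm z ∈ U :=
  (continuousAt_extChartAt_symm'' hy).preimage_mem_nhds hU

theorem fderiv_transition_self {a : P} {y : E} (hy : y ∈ (extChartAt 𝓘(ℝ, E) a).target) :
    fderiv ℝ (transition (E := E) a a) y = ContinuousLinearMap.id ℝ E := by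
  rw [← fderiv_id (𝕜 := ℝ) (x := y)]
  refine Filter.EventuallyEq.fderiv_eq ?_
  filter_upwards [eventually_mem_target hy] with z hz
  exact (extChartAt 𝓘(ℝ, E) a).right_inv hz

section Transition

variable [IsManifold 𝓘(ℝ, E) ∞ P]

theorem contDiffAt_transition {a b : P} {y : E} (hy : y ∈ (extChartAt 𝓘(ℝ, E) a).target)
    (hb : (extChartAt 𝓘(ℝ, E) a).symm y ∈ (extChartAt 𝓘(ℝ, E) b).source) :
    ContDiffAt ℝ ∞ (transition (E := E) a b) y := by
  have h := contDiffWithinAt_ext_coord_change (I := 𝓘(ℝ, E)) (n := ∞) b a (y := y) (by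
    rw [PartialEquiv.trans_source, PartialEquiv.symm_source]
    exact ⟨hy, hb⟩)
  rwa [modelWithCornersSelf_coe, Set.range_id, contDiffWithinAt_univ] at h

theorem fderiv_transition_comp {a b c : P} {y : E} (hy : y ∈ (extChartAt 𝓘(ℝ, E) a).target)
    (hb : (extChartAt 𝓘(ℝ, E) a).symm y ∈ (extChartAt 𝓘(ℝ, E) b).source)
    (hc : (extChartAt 𝓘(ℝ, E) a).symm y ∈ (extChartAt 𝓘(ℝ, E) c).source) :
    (fderiv ℝ (transition (E := E) b c) (transition a b y)).comp
      (fderiv ℝ (transition (E := E) a b) y) = fderiv ℝ (transition (E := E) a c) y := by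
  have h1 := (contDiffAt_transition hy hb).differentiableAt (by simp)
  have hs : (extChartAt 𝓘(ℝ, E) b).symm (transition a b y) = (extChartAt 𝓘(ℝ, E) a).symm y :=
    (extChartAt 𝓘(ℝ, E) b).left_inv hb
  have ht : transition a b y ∈ (extChartAt 𝓘(ℝ, E) b).target :=
    (extChartAt 𝓘(ℝ, E) b).map_source hb
  have h2 := (contDiffAt_transition (b := c) ht (by rw [hs]; exact hc)).differentiableAt
    (by simp)
  rw [← fderiv_comp y h2 h1]
  refine Filter.EventuallyEq.fderiv_eq ?_
  filter_upwards [eventually_symm_mem hy ((isOpen_extChartAt_source b).mem_nhds hb)] with z hz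
  change extChartAt 𝓘(ℝ, E) c ((extChartAt 𝓘(ℝ, E) b).symm (extChartAt 𝓘(ℝ, E) b _)) = _
  rw [(extChartAt 𝓘(ℝ, E) b).left_inv hz]
  rfl

/-- The identification of the tangent space at a point `p` with `E` is the one given by the preferred
chart at `p`, so that `chartMap` is the derivative of a change of coordinates into that chart. -/
theorem chartMap_eq_fderiv {a : P} {y : E} (hy : y ∈ (extChartAt 𝓘(ℝ, E) a).target) :
    chartMap a y = fderiv ℝ (transition (E := E) a ((extChartAt 𝓘(ℝ, E) a).symm y)) y := by
  have : IsManifold 𝓘(ℝ, E) 1 P := IsManifold.of_le (n := ∞) (by simp)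
  have hd : MDifferentiableAt 𝓘(ℝ, E) 𝓘(ℝ, E) (extChartAt 𝓘(ℝ, E) a).symm y := by
    have := mdifferentiableWithinAt_extChartAt_symm hy
    rwa [modelWithCornersSelf_coe, Set.range_id, mdifferentiableWithinAt_univ] at this
  have h : chartMap a y = fderivWithin ℝ (writtenInExtChartAt 𝓘(ℝ, E) 𝓘(ℝ, E) y
      (extChartAt 𝓘(ℝ, E) a).symm) (Set.range 𝓘(ℝ, E)) (extChartAt 𝓘(ℝ, E) y y) :=
    hd.mfderiv
  rw [h, modelWithCornersSelf_coe, Set.range_id, fderivWithin_univ]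
  rfl

theorem chartMap_transition {a b : P} {y : E} (hy : y ∈ (extChartAt 𝓘(ℝ, E) a).target)
    (hb : (extChartAt 𝓘(ℝ, E) a).symm y ∈ (extChartAt 𝓘(ℝ, E) b).source) :
    (chartMap b (transition a b y)).comp (fderiv ℝ (transition (E := E) a b) y) =
      chartMap a y := by
  have hs : (extChartAt 𝓘(ℝ, E) b).symm (transition a b y) = (extChartAt 𝓘(ℝ, E) a).symm y :=
    (extChartAt 𝓘(ℝ, E) b).left_inv hb
  rw [chartMap_eq_fderiv hy,
    chartMap_eq_fderiv (y := transition a b y) ((extChartAt 𝓘(ℝ, E) b).map_source hb), hs]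
  exact fderiv_transition_comp hy hb (mem_extChartAt_source _)

/-- The inverse of the derivative of the inverse chart. -/
theorem chartMap_inverse {a : P} {y : E} (hy : y ∈ (extChartAt 𝓘(ℝ, E) a).target) :
    (fderiv ℝ (transition (E := E) ((extChartAt 𝓘(ℝ, E) a).symm y) a)
      (extChartAt 𝓘(ℝ, E) ((extChartAt 𝓘(ℝ, E) a).symm y) ((extChartAt 𝓘(ℝ, E) a).symm y))).comp
        (chartMap a y) = ContinuousLinearMap.id ℝ E ∧
    (chartMap a y).comp (fderiv ℝ (transition (E := E) ((extChartAt 𝓘(ℝ, E) a).symm y) a)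
      (extChartAt 𝓘(ℝ, E) ((extChartAt 𝓘(ℝ, E) a).symm y) ((extChartAt 𝓘(ℝ, E) a).symm y))) =
        ContinuousLinearMap.id ℝ E := by
  set p := (extChartAt 𝓘(ℝ, E) a).symm y with hp
  have hpa : p ∈ (extChartAt 𝓘(ℝ, E) a).source := (extChartAt 𝓘(ℝ, E) a).map_target hy
  have hpp : p ∈ (extChartAt 𝓘(ℝ, E) p).source := mem_extChartAt_source p
  have hq : extChartAt 𝓘(ℝ, E) p p ∈ (extChartAt 𝓘(ℝ, E) p).target := mem_extChartAt_target p
  have hqs : (extChartAt 𝓘(ℝ, E) p).symm (extChartAt 𝓘(ℝ, E) p p) = p := extChartAt_to_inv p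
  have hqy : transition p a (extChartAt 𝓘(ℝ, E) p p) = y := by
    change extChartAt 𝓘(ℝ, E) a ((extChartAt 𝓘(ℝ, E) p).symm (extChartAt 𝓘(ℝ, E) p p)) = y
    rw [hqs]
    exact (extChartAt 𝓘(ℝ, E) a).right_inv hy
  rw [chartMap_eq_fderiv hy]
  constructor
  · exact (fderiv_transition_comp (b := p) (c := a) hy hpp hpa).trans (fderiv_transition_self hy)
  · have h := fderiv_transition_comp (a := p) (b := a) (c := p) hq (by rw [hqs]; exact hpa)
      (by rw [hqs]; exact hpp)
    rw [hqy] at h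
    exact h.trans (fderiv_transition_self hq)

theorem chartMap_chartVField {a : P} {y : E} (hy : y ∈ (extChartAt 𝓘(ℝ, E) a).target)
    (X : VField E P) :
    chartMap a y (chartVField a X y) = rawField X ((extChartAt 𝓘(ℝ, E) a).symm y) := by
  obtain ⟨h1, h2⟩ := chartMap_inverse hy
  rw [chartVField_eq, ContinuousLinearMap.inverse_eq h2 h1]
  exact congrArg (fun f : E →L[ℝ] E => f (rawField X ((extChartAt 𝓘(ℝ, E) a).symm y))) h2

theorem chartMap_bijective {a : P} {y : E} (hy : y ∈ (extChartAt 𝓘(ℝ, E) a).target) :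
    Function.Bijective (chartMap a y) := by
  obtain ⟨h1, h2⟩ := chartMap_inverse hy
  exact ⟨Function.LeftInverse.injective fun v => congrArg (fun f : E →L[ℝ] E => f v) h1,
    Function.RightInverse.surjective fun v => congrArg (fun f : E →L[ℝ] E => f v) h2⟩

/-- In the preferred chart at `x`, the identification of the tangent space at `x` with the model space
is the identity. -/
theorem chartMap_self (x : P) :
    chartMap x (extChartAt 𝓘(ℝ, E) x x) = ContinuousLinearMap.id ℝ E := by
  rw [chartMap_eq_fderiv (mem_extChartAt_target x), extChartAt_to_inv]
  exact fderiv_transition_self (mem_extChartAt_target x)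

/-- `fromChart` is the identity, once tangent spaces are identified with the model space. -/
theorem fromChart_eq {k : ℕ} (x : P) (α : E [⋀^Fin k]→L[ℝ] ℝ) :
    fromChart x α = (α : TangentSpace 𝓘(ℝ, E) x [⋀^Fin k]→L[ℝ] ℝ) := by
  have : IsManifold 𝓘(ℝ, E) 1 P := IsManifold.of_le (n := ∞) (by simp)
  have hd : MDifferentiableAt 𝓘(ℝ, E) 𝓘(ℝ, E) (extChartAt 𝓘(ℝ, E) x) x :=
    mdifferentiableAt_extChartAt (mem_chart_source E x)
  have h : (mfderiv 𝓘(ℝ, E) 𝓘(ℝ, E) (extChartAt 𝓘(ℝ, E) x) x : E →L[ℝ] E) =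
      ContinuousLinearMap.id ℝ E := by
    refine hd.mfderiv.trans ?_
    rw [← fderiv_transition_self (mem_extChartAt_target x), modelWithCornersSelf_coe, Set.range_id,
      fderivWithin_univ]
    rfl
  change ContinuousAlternatingMap.compContinuousLinearMap α
    (mfderiv 𝓘(ℝ, E) 𝓘(ℝ, E) (extChartAt 𝓘(ℝ, E) x) x : E →L[ℝ] E) = _
  rw [h]
  rfl

theorem chartForm_self {k : ℕ} (x : P) (θ : DForm E P k) :
    chartForm x θ (extChartAt 𝓘(ℝ, E) x x) = rawForm θ x := by
  rw [chartForm_eq, chartMap_self, extChartAt_to_inv]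
  rfl

theorem chartVField_self (x : P) (X : VField E P) :
    chartVField x X (extChartAt 𝓘(ℝ, E) x x) = rawField X x := by
  rw [chartVField_eq, chartMap_self, extChartAt_to_inv, ContinuousLinearMap.inverse_id]
  rfl

theorem rawForm_d {k : ℕ} (θ : DForm E P k) (x : P) :
    rawForm (d θ) x = extDeriv (chartForm x θ) (extChartAt 𝓘(ℝ, E) x x) :=
  fromChart_eq x _

theorem rawForm_lieD {k : ℕ} (X : VField E P) (θ : DForm E P k) (x : P) :
    rawForm (lieD X θ) x =
      lieDerivForm (chartVField x X) (chartForm x θ) (extChartAt 𝓘(ℝ, E) x x) :=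
  fromChart_eq x _

/-- Coordinate expressions of a form are pulled back to one another by changes of coordinates. -/
theorem chartForm_transition {k : ℕ} (θ : DForm E P k) {a b : P} {y : E}
    (hy : y ∈ (extChartAt 𝓘(ℝ, E) a).target)
    (hb : (extChartAt 𝓘(ℝ, E) a).symm y ∈ (extChartAt 𝓘(ℝ, E) b).source) :
    chartForm a θ y = (chartForm b θ (transition a b y)).compContinuousLinearMap
      (fderiv ℝ (transition (E := E) a b) y) := by
  have hs : (extChartAt 𝓘(ℝ, E) b).symm (transition a b y) = (extChartAt 𝓘(ℝ, E) a).symm y :=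
    (extChartAt 𝓘(ℝ, E) b).left_inv hb
  rw [chartForm_eq, chartForm_eq, ← chartMap_transition hy hb, hs]
  rfl

/-- Coordinate expressions of a vector field are related by changes of coordinates. -/
theorem chartVField_transition (X : VField E P) {a b : P} {y : E}
    (hy : y ∈ (extChartAt 𝓘(ℝ, E) a).target)
    (hb : (extChartAt 𝓘(ℝ, E) a).symm y ∈ (extChartAt 𝓘(ℝ, E) b).source) :
    fderiv ℝ (transition (E := E) a b) y (chartVField a X y) =
      chartVField b X (transition a b y) := by
  have hs : (extChartAt 𝓘(ℝ, E) b).symm (transition a b y) = (extChartAt 𝓘(ℝ, E) a).symm y :=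
    (extChartAt 𝓘(ℝ, E) b).left_inv hb
  have ht : transition a b y ∈ (extChartAt 𝓘(ℝ, E) b).target :=
    (extChartAt 𝓘(ℝ, E) b).map_source hb
  refine (chartMap_bijective (a := b) (y := transition a b y) ht).1 ?_
  rw [chartMap_chartVField ht, hs, ← chartMap_chartVField hy, ← chartMap_transition hy hb]
  rfl

end Transition

end Charts

/-! ### Exterior and Lie derivatives on a manifold -/

section ManifoldCalculus

variable {E : Type*} [NormedAddCommGroup E] [NormedSpace ℝ E]
  {P : Type*} [TopologicalSpace P] [ChartedSpace E P]

theorem contMDiff_of_chartFun {f : P → ℝ}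
    (hf : ∀ a : P, ContDiffAt ℝ ∞ (f ∘ (extChartAt 𝓘(ℝ, E) a).symm) (extChartAt 𝓘(ℝ, E) a a)) :
    ContMDiff 𝓘(ℝ, E) 𝓘(ℝ, ℝ) ∞ f := by
  intro a
  have h : ContMDiffAt 𝓘(ℝ, E) 𝓘(ℝ, ℝ) ∞
      ((f ∘ (extChartAt 𝓘(ℝ, E) a).symm) ∘ extChartAt 𝓘(ℝ, E) a) a :=
    (contMDiffAt_iff_contDiffAt.2 (hf a)).comp a contMDiffAt_extChartAt
  refine h.congr_of_eventuallyEq ?_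
  filter_upwards [extChartAt_source_mem_nhds (I := 𝓘(ℝ, E)) a] with z hz
  exact congrArg f ((extChartAt 𝓘(ℝ, E) a).left_inv hz).symm

theorem IsSmoothForm.contDiffAt {k : ℕ} {θ : DForm E P k} (hθ : IsSmoothForm θ) {a : P} {y : E}
    (hy : y ∈ (extChartAt 𝓘(ℝ, E) a).target) : ContDiffAt ℝ ∞ (chartForm a θ) y :=
  (hθ a).contDiffAt ((isOpen_extChartAt_target a).mem_nhds hy)

theorem isSmoothForm_of_contDiffAt {k : ℕ} {θ : DForm E P k}
    (h : ∀ (a : P), ∀ y ∈ (extChartAt 𝓘(ℝ, E) a).target, ContDiffAt ℝ ∞ (chartForm a θ) y) :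
    IsSmoothForm θ := fun a y hy => (h a y hy).contDiffWithinAt

theorem chartVField_sub (X Y : VField E P) (a : P) (y : E) :
    chartVField a (fun x => X x - Y x) y = chartVField a X y - chartVField a Y y :=
  map_sub _ _ _

theorem chartForm_eventuallyEq {k : ℕ} {θ θ' : DForm E P k} {x : P} (h : ∀ᶠ p in 𝓝 x, θ p = θ' p) :
    chartForm x θ =ᶠ[𝓝 (extChartAt 𝓘(ℝ, E) x x)] chartForm x θ' := by
  have hx := mem_extChartAt_target (I := 𝓘(ℝ, E)) x
  have h' : {p | θ p = θ' p} ∈ 𝓝 ((extChartAt 𝓘(ℝ, E) x).symm (extChartAt 𝓘(ℝ, E) x x)) := by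
    rw [extChartAt_to_inv]; exact h
  filter_upwards [eventually_symm_mem hx h'] with z hz
  rw [chartForm, hz]
  rfl

theorem chartVField_eventuallyEq {X Y : VField E P} {x : P} (h : ∀ᶠ p in 𝓝 x, X p = Y p) :
    chartVField x X =ᶠ[𝓝 (extChartAt 𝓘(ℝ, E) x x)] chartVField x Y := by
  have hx := mem_extChartAt_target (I := 𝓘(ℝ, E)) x
  have h' : {p | X p = Y p} ∈ 𝓝 ((extChartAt 𝓘(ℝ, E) x).symm (extChartAt 𝓘(ℝ, E) x x)) := by
    rw [extChartAt_to_inv]; exact h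
  filter_upwards [eventually_symm_mem hx h'] with z hz
  exact congrArg (chartMap x z).inverse hz

variable [IsManifold 𝓘(ℝ, E) ∞ P]

theorem contDiffAt_chartFun {f : P → ℝ} (hf : ContMDiff 𝓘(ℝ, E) 𝓘(ℝ, ℝ) ∞ f) {a : P} {y : E}
    (hy : y ∈ (extChartAt 𝓘(ℝ, E) a).target) :
    ContDiffAt ℝ ∞ (f ∘ (extChartAt 𝓘(ℝ, E) a).symm) y := by
  rw [← contMDiffAt_iff_contDiffAt]
  refine hf.contMDiffAt.comp y ?_
  exact (contMDiffOn_extChartAt_symm a).contMDiffAt ((isOpen_extChartAt_target a).mem_nhds hy)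

/-- The differential of a function, with the tangent spaces identified with the model space. -/
noncomputable def rawDiff (f : P → ℝ) (p : P) : E → ℝ := fun v => dFun (E := E) f p v

theorem fderiv_chartFun {f : P → ℝ} (hf : ContMDiff 𝓘(ℝ, E) 𝓘(ℝ, ℝ) ∞ f) {a : P} {y : E}
    (hy : y ∈ (extChartAt 𝓘(ℝ, E) a).target) (v : E) :
    fderiv ℝ (f ∘ (extChartAt 𝓘(ℝ, E) a).symm) y v =
      rawDiff f ((extChartAt 𝓘(ℝ, E) a).symm y) (chartMap a y v) := by
  have : IsManifold 𝓘(ℝ, E) 1 P := IsManifold.of_le (n := ∞) (by simp)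
  have hd : MDifferentiableAt 𝓘(ℝ, E) 𝓘(ℝ, E) (extChartAt 𝓘(ℝ, E) a).symm y := by
    have := mdifferentiableWithinAt_extChartAt_symm hy
    rwa [modelWithCornersSelf_coe, Set.range_id, mdifferentiableWithinAt_univ] at this
  have hf' : MDifferentiableAt 𝓘(ℝ, E) 𝓘(ℝ, ℝ) f ((extChartAt 𝓘(ℝ, E) a).symm y) :=
    hf.mdifferentiableAt (by simp)
  have h := mfderiv_comp y hf' hd
  rw [mfderiv_eq_fderiv] at h
  exact congrArg (fun g : E →L[ℝ] ℝ => g v) h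

theorem rawDiff_eq_fderiv {f : P → ℝ} (hf : ContMDiff 𝓘(ℝ, E) 𝓘(ℝ, ℝ) ∞ f) (x : P) (v : E) :
    rawDiff f x v = fderiv ℝ (f ∘ (extChartAt 𝓘(ℝ, E) x).symm) (extChartAt 𝓘(ℝ, E) x x) v := by
  rw [fderiv_chartFun hf (mem_extChartAt_target x), chartMap_self, extChartAt_to_inv]
  rfl

/-- The exterior derivative on a manifold can be computed in any preferred chart. -/
theorem chartForm_d {k : ℕ} {θ : DForm E P k} (hθ : IsSmoothForm θ) {a : P} {y : E}
    (hy : y ∈ (extChartAt 𝓘(ℝ, E) a).target) :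
    chartForm a (d θ) y = extDeriv (chartForm a θ) y := by
  set x := (extChartAt 𝓘(ℝ, E) a).symm y with hx
  have hxx : (extChartAt 𝓘(ℝ, E) a).symm y ∈ (extChartAt 𝓘(ℝ, E) x).source :=
    mem_extChartAt_source x
  have hev : chartForm a θ =ᶠ[𝓝 y] fun z => (chartForm x θ (transition a x z)
      ).compContinuousLinearMap (fderiv ℝ (transition (E := E) a x) z) := by
    filter_upwards [eventually_mem_target hy,
      eventually_symm_mem hy ((isOpen_extChartAt_source x).mem_nhds hxx)] with z hz hz'
    exact chartForm_transition θ hz hz'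
  have hd : DifferentiableAt ℝ (chartForm x θ) (transition a x y) :=
    (hθ.contDiffAt (mem_extChartAt_target x)).differentiableAt (by simp)
  rw [chartForm_eq, rawForm_d, hev.extDeriv_eq, extDeriv_pullback (r := 2) hd
    ((contDiffAt_transition hy hxx).of_le (by norm_cast)) (by simp),
    chartMap_eq_fderiv hy]
  rfl

theorem contDiffAt_extDeriv {k : ℕ} {α : E → E [⋀^Fin k]→L[ℝ] ℝ} {y : E}
    (hα : ContDiffAt ℝ ∞ α y) : ContDiffAt ℝ ∞ (extDeriv α) y :=
  ContDiffAt.continuousLinearMap_comp (f := fderiv ℝ α)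
    (ContinuousAlternatingMap.alternatizeUncurryFinCLM ℝ E ℝ) (hα.fderiv_right (by simp))

theorem contDiffAt_lieDerivForm {k : ℕ} {X : E → E} {α : E → E [⋀^Fin k]→L[ℝ] ℝ} {y : E}
    (hX : ContDiffAt ℝ ∞ X y) (hα : ContDiffAt ℝ ∞ α y) :
    ContDiffAt ℝ ∞ (lieDerivForm X α) y := by
  refine ContDiffAt.add ((hα.fderiv_right (m := ∞) (by simp)).clm_apply hX) ?_
  have h : ContDiffAt ℝ ∞ (fun z =>
      ContinuousAlternatingMap.fderivCompContinuousLinearMapCLM ℝ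
        (ContinuousLinearMap.id ℝ E) (α z)) y := hα.continuousLinearMap_comp _
  exact h.clm_apply (hX.fderiv_right (m := ∞) (by simp))

theorem chartVField_eq_trivialization (X : VField E P) {a : P} {y : E}
    (hy : y ∈ (extChartAt 𝓘(ℝ, E) a).target) :
    chartVField a X y = (trivializationAt E (TangentSpace 𝓘(ℝ, E) : P → Type _) a
      ⟨(extChartAt 𝓘(ℝ, E) a).symm y, X ((extChartAt 𝓘(ℝ, E) a).symm y)⟩).2 := by
  obtain ⟨h1, h2⟩ := chartMap_inverse hy
  rw [chartVField_eq, ContinuousLinearMap.inverse_eq h2 h1, TangentBundle.trivializationAt_apply,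
    modelWithCornersSelf_coe, Set.range_id, fderivWithin_univ]
  rfl

theorem IsSmoothVField.contDiffAt {X : VField E P} (hX : IsSmoothVField X) {a : P} {y : E}
    (hy : y ∈ (extChartAt 𝓘(ℝ, E) a).target) : ContDiffAt ℝ ∞ (chartVField a X) y := by
  have hp : (extChartAt 𝓘(ℝ, E) a).symm y ∈
      (trivializationAt E (TangentSpace 𝓘(ℝ, E) : P → Type _) a).baseSet := by
    rw [TangentBundle.trivializationAt_baseSet, ← extChartAt_source 𝓘(ℝ, E)]
    exact (extChartAt 𝓘(ℝ, E) a).map_target hy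
  have h1 := ((trivializationAt E (TangentSpace 𝓘(ℝ, E) : P → Type _) a).contMDiffAt_section_iff
    (n := ∞) (IB := 𝓘(ℝ, E)) hp).1 (hX _)
  have h2 := h1.comp y
    ((contMDiffOn_extChartAt_symm a).contMDiffAt ((isOpen_extChartAt_target a).mem_nhds hy))
  refine (contMDiffAt_iff_contDiffAt.1 h2).congr_of_eventuallyEq ?_
  filter_upwards [eventually_mem_target hy] with z hz
  exact chartVField_eq_trivialization X hz

theorem isSmoothVField_of_contDiffAt {X : VField E P}
    (h : ∀ a : P, ContDiffAt ℝ ∞ (chartVField a X) (extChartAt 𝓘(ℝ, E) a a)) :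
    IsSmoothVField X := by
  intro a
  refine (Bundle.contMDiffAt_section a).2 ?_
  have h1 : ContMDiffAt 𝓘(ℝ, E) 𝓘(ℝ, E) ∞ (chartVField a X ∘ extChartAt 𝓘(ℝ, E) a) a :=
    (contMDiffAt_iff_contDiffAt.2 (h a)).comp a contMDiffAt_extChartAt
  refine h1.congr_of_eventuallyEq ?_
  filter_upwards [extChartAt_source_mem_nhds (I := 𝓘(ℝ, E)) a] with z hz
  have := chartVField_eq_trivialization X ((extChartAt 𝓘(ℝ, E) a).map_source hz)
  rw [(extChartAt 𝓘(ℝ, E) a).left_inv hz] at this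
  exact this.symm

/-- The Lie derivative on a manifold can be computed in any preferred chart. -/
theorem chartForm_lieD {k : ℕ} {X : VField E P} (hX : IsSmoothVField X) {θ : DForm E P k}
    (hθ : IsSmoothForm θ) {a : P} {y : E} (hy : y ∈ (extChartAt 𝓘(ℝ, E) a).target) :
    chartForm a (lieD X θ) y = lieDerivForm (chartVField a X) (chartForm a θ) y := by
  set x := (extChartAt 𝓘(ℝ, E) a).symm y with hx
  have hxx : (extChartAt 𝓘(ℝ, E) a).symm y ∈ (extChartAt 𝓘(ℝ, E) x).source :=
    mem_extChartAt_source x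
  have hev : chartForm a θ =ᶠ[𝓝 y] fun z => (chartForm x θ (transition a x z)
      ).compContinuousLinearMap (fderiv ℝ (transition (E := E) a x) z) := by
    filter_upwards [eventually_mem_target hy,
      eventually_symm_mem hy ((isOpen_extChartAt_source x).mem_nhds hxx)] with z hz hz'
    exact chartForm_transition θ hz hz'
  have hrel : ∀ᶠ z in 𝓝 y, fderiv ℝ (transition (E := E) a x) z (chartVField a X z) =
      chartVField x X (transition a x z) := by
    filter_upwards [eventually_mem_target hy,
      eventually_symm_mem hy ((isOpen_extChartAt_source x).mem_nhds hxx)] with z hz hz'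
    exact chartVField_transition X hz hz'
  rw [chartForm_eq, rawForm_lieD, lieDerivForm_congr (Filter.EventuallyEq.refl _ _) hev,
    lieDerivForm_pullback ((contDiffAt_transition hy hxx).of_le (by norm_cast))
    ((hX.contDiffAt (mem_extChartAt_target x)).differentiableAt (by simp))
    ((hX.contDiffAt hy).differentiableAt (by simp))
    ((hθ.contDiffAt (mem_extChartAt_target x)).differentiableAt (by simp)) hrel,
    chartMap_eq_fderiv hy]
  rfl

theorem IsSmoothForm.lieD {k : ℕ} {X : VField E P} (hX : IsSmoothVField X) {θ : DForm E P k}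
    (hθ : IsSmoothForm θ) : IsSmoothForm (ContactNonholonomic.lieD X θ) := by
  refine isSmoothForm_of_contDiffAt fun a y hy => ?_
  refine (contDiffAt_lieDerivForm (hX.contDiffAt hy) (hθ.contDiffAt hy)).congr_of_eventuallyEq ?_
  filter_upwards [eventually_mem_target hy] with z hz
  exact chartForm_lieD hX hθ hz

theorem IsSmoothForm.smul {k : ℕ} {f : P → ℝ} (hf : ContMDiff 𝓘(ℝ, E) 𝓘(ℝ, ℝ) ∞ f)
    {θ : DForm E P k} (hθ : IsSmoothForm θ) :
    IsSmoothForm (fun x => f x • θ x : DForm E P k) :=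
  isSmoothForm_of_contDiffAt fun _ _ hy => (contDiffAt_chartFun hf hy).smul (hθ.contDiffAt hy)

theorem IsSmoothVField.sub {X Y : VField E P} (hX : IsSmoothVField X) (hY : IsSmoothVField Y) :
    IsSmoothVField (fun x => X x - Y x : VField E P) := by
  refine isSmoothVField_of_contDiffAt fun a => ?_
  exact ((hX.contDiffAt (mem_extChartAt_target a)).sub
    (hY.contDiffAt (mem_extChartAt_target a))).congr_of_eventuallyEq
      (Filter.Eventually.of_forall fun y => chartVField_sub X Y a y)

theorem IsSmoothVField.add {X Y : VField E P} (hX : IsSmoothVField X) (hY : IsSmoothVField Y) :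
    IsSmoothVField (fun x => X x + Y x : VField E P) := by
  refine isSmoothVField_of_contDiffAt fun a => ?_
  exact ((hX.contDiffAt (mem_extChartAt_target a)).add
    (hY.contDiffAt (mem_extChartAt_target a))).congr_of_eventuallyEq
      (Filter.Eventually.of_forall fun y => map_add _ _ _)

/-- The function `θ(X)` can be computed in any preferred chart. -/
theorem chartForm_pairing (θ : DForm E P 1) (X : VField E P) {a : P} {y : E}
    (hy : y ∈ (extChartAt 𝓘(ℝ, E) a).target) :
    chartForm a θ y ![chartVField a X y] =
      oneForm (θ ((extChartAt 𝓘(ℝ, E) a).symm y)) (X ((extChartAt 𝓘(ℝ, E) a).symm y)) := by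
  have h : rawForm θ ((extChartAt 𝓘(ℝ, E) a).symm y) (chartMap a y ∘ ![chartVField a X y]) =
      rawForm θ ((extChartAt 𝓘(ℝ, E) a).symm y)
        ![rawField X ((extChartAt 𝓘(ℝ, E) a).symm y)] := by
    congr 1
    funext i
    fin_cases i
    exact chartMap_chartVField hy X
  exact h.trans (oneForm_apply (θ _) (X _)).symm

theorem contDiffAt_oneForm_apply {α : E → E [⋀^Fin 1]→L[ℝ] ℝ} {X : E → E} {y : E}
    (hα : ContDiffAt ℝ ∞ α y) (hX : ContDiffAt ℝ ∞ X y) [FiniteDimensional ℝ E] :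
    ContDiffAt ℝ ∞ (fun z => α z ![X z]) y := by
  have := finiteDimensional_forms (E := E) 1
  let J : (E [⋀^Fin 1]→L[ℝ] ℝ) →L[ℝ] (E →L[ℝ] ℝ) := LinearMap.toContinuousLinearMap
    { toFun := (ContinuousAlternatingMap.ofSubsingleton ℝ E ℝ (0 : Fin 1)).symm
      map_add' := fun _ _ => rfl
      map_smul' := fun _ _ => rfl }
  have hJ (β : E [⋀^Fin 1]→L[ℝ] ℝ) (v : E) : J β v = β ![v] := oneForm_apply β v
  simp only [← hJ]
  exact (J.contDiff.contDiffAt.comp y hα).clm_apply hX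

theorem contMDiff_pairing [FiniteDimensional ℝ E] {θ : DForm E P 1} (hθ : IsSmoothForm θ)
    {X : VField E P} (hX : IsSmoothVField X) :
    ContMDiff 𝓘(ℝ, E) 𝓘(ℝ, ℝ) ∞ (fun x => oneForm (θ x) (X x)) := by
  refine contMDiff_of_chartFun fun a => ?_
  refine (contDiffAt_oneForm_apply (hθ.contDiffAt (mem_extChartAt_target a))
    (hX.contDiffAt (mem_extChartAt_target a))).congr_of_eventuallyEq ?_
  filter_upwards [eventually_mem_target (mem_extChartAt_target (I := 𝓘(ℝ, E)) a)] with z hz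
  exact (chartForm_pairing θ X hz).symm

theorem contMDiff_dFun_apply [FiniteDimensional ℝ E] {f : P → ℝ}
    (hf : ContMDiff 𝓘(ℝ, E) 𝓘(ℝ, ℝ) ∞ f) {X : VField E P} (hX : IsSmoothVField X) :
    ContMDiff 𝓘(ℝ, E) 𝓘(ℝ, ℝ) ∞ (fun x => dFun f x (X x)) := by
  refine contMDiff_of_chartFun fun a => ?_
  have h : ContDiffAt ℝ ∞ (fun y => fderiv ℝ (f ∘ (extChartAt 𝓘(ℝ, E) a).symm) y
      (chartVField a X y)) (extChartAt 𝓘(ℝ, E) a a) :=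
    ((contDiffAt_chartFun hf (mem_extChartAt_target a)).fderiv_right (m := ∞) (by simp)).clm_apply
      (hX.contDiffAt (mem_extChartAt_target a))
  refine h.congr_of_eventuallyEq ?_
  filter_upwards [eventually_mem_target (mem_extChartAt_target (I := 𝓘(ℝ, E)) a)] with z hz
  rw [fderiv_chartFun hf hz, chartMap_chartVField hz]
  rfl

theorem rawForm_lieD_cartan [FiniteDimensional ℝ E] {X : VField E P} (hX : IsSmoothVField X)
    {θ : DForm E P 1} (hθ : IsSmoothForm θ) (x : P) (v : E) :
    rawForm (lieD X θ) x ![v] = rawForm (d θ) x ![rawField X x, v] +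
      rawDiff (fun p => oneForm (θ p) (X p)) x v := by
  have hx := mem_extChartAt_target (I := 𝓘(ℝ, E)) x
  rw [rawForm_lieD, rawForm_d, rawDiff_eq_fderiv (contMDiff_pairing hθ hX),
    lieDerivForm_one_eq_cartan ((hX.contDiffAt hx).differentiableAt (by simp))
      ((hθ.contDiffAt hx).differentiableAt (by simp)), chartVField_self]
  refine congrArg (_ + ·) (congrArg (fun g : E →L[ℝ] ℝ => g v) (Filter.EventuallyEq.fderiv_eq ?_))
  filter_upwards [eventually_mem_target hx] with z hz
  exact chartForm_pairing θ X hz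

/-- Cartan's formula `L_X θ = ι_X dθ + d(θ(X))` for one-forms on a manifold. -/
theorem lieD_one_eq_cartan [FiniteDimensional ℝ E] {X : VField E P} (hX : IsSmoothVField X)
    {θ : DForm E P 1} (hθ : IsSmoothForm θ) (x : P) (v : TangentSpace 𝓘(ℝ, E) x) :
    oneForm (lieD X θ x) v =
      d θ x ![X x, v] + dFun (fun p => oneForm (θ p) (X p)) x v :=
  (oneForm_apply _ _).trans (rawForm_lieD_cartan hX hθ x v)

/-- `d L_X θ = L_X dθ` for one-forms, computed in the preferred chart. -/
theorem d_lieD_one {X : VField E P} (hX : IsSmoothVField X) {θ : DForm E P 1}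
    (hθ : IsSmoothForm θ) (x : P) : rawForm (d (lieD X θ)) x =
      lieDerivForm (chartVField x X) (extDeriv (chartForm x θ)) (extChartAt 𝓘(ℝ, E) x x) := by
  have hx := mem_extChartAt_target (I := 𝓘(ℝ, E)) x
  have h2 : (2 : ℕ∞ω) ≤ ∞ := by norm_cast
  rw [rawForm_d, lieDerivForm_extDeriv ((hX.contDiffAt hx).of_le h2) ((hθ.contDiffAt hx).of_le h2)]
  refine Filter.EventuallyEq.extDeriv_eq ?_
  filter_upwards [eventually_mem_target hx] with z hz
  exact chartForm_lieD hX hθ hz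

/-- Leibniz rule for the Lie derivative of `θ ∧ (dθ) ^ n`. -/
theorem lieD_volumeForm [FiniteDimensional ℝ E] {X : VField E P} (hX : IsSmoothVField X)
    {θ : DForm E P 1} (hθ : IsSmoothForm θ) (n : ℕ) (x : P) :
    lieD X (volumeForm n θ) x = wedge (lieD X θ x) (wedgePow (d θ x) n) +
      wedgeCross (θ x) (d θ x) (d (lieD X θ) x) n := by
  have hx := mem_extChartAt_target (I := 𝓘(ℝ, E)) x
  change rawForm (lieD X (volumeForm n θ)) x =
    wedge (rawForm (lieD X θ) x) (wedgePow (rawForm (d θ) x) n) +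
      wedgeCross (rawForm θ x) (rawForm (d θ) x) (rawForm (d (lieD X θ)) x) n
  have hev : chartForm x (volumeForm n θ) =ᶠ[𝓝 (extChartAt 𝓘(ℝ, E) x x)]
      fun z => wedge (chartForm x θ z) (wedgePow (extDeriv (chartForm x θ) z) n) := by
    filter_upwards [eventually_mem_target hx] with z hz
    have h : chartForm x (volumeForm n θ) z =
        (wedge (rawForm θ ((extChartAt 𝓘(ℝ, E) x).symm z))
          (wedgePow (rawForm (d θ) ((extChartAt 𝓘(ℝ, E) x).symm z)) n)
            ).compContinuousLinearMap (chartMap x z) := rfl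
    rw [h, wedge_comp, wedgePow_comp, ← chartForm_eq, ← chartForm_eq, chartForm_d hθ hz]
  rw [rawForm_lieD, lieDerivForm_congr (Filter.EventuallyEq.refl _ _) hev,
    lieDerivForm_wedge_wedgePow _ ((hθ.contDiffAt hx).differentiableAt (by simp))
      ((contDiffAt_extDeriv (hθ.contDiffAt hx)).differentiableAt (by simp)),
    d_lieD_one hX hθ, rawForm_lieD, rawForm_d, chartForm_self]

theorem d_congr {k : ℕ} {θ θ' : DForm E P k} {x : P} (h : ∀ᶠ p in 𝓝 x, θ p = θ' p) :
    d θ x = d θ' x := by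
  change rawForm (d θ) x = rawForm (d θ') x
  rw [rawForm_d, rawForm_d, (chartForm_eventuallyEq h).extDeriv_eq]

theorem lieD_congr {k : ℕ} {X Y : VField E P} {θ : DForm E P k} {x : P}
    (h : ∀ᶠ p in 𝓝 x, X p = Y p) : lieD X θ x = lieD Y θ x := by
  change rawForm (lieD X θ) x = rawForm (lieD Y θ) x
  rw [rawForm_lieD, rawForm_lieD,
    lieDerivForm_congr (chartVField_eventuallyEq h) (Filter.EventuallyEq.refl _ _)]

theorem lieD_add_field {k : ℕ} {X Y : VField E P} (hX : IsSmoothVField X) (hY : IsSmoothVField Y)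
    (θ : DForm E P k) (x : P) :
    lieD (fun p => X p + Y p) θ x = lieD X θ x + lieD Y θ x := by
  have hx := mem_extChartAt_target (I := 𝓘(ℝ, E)) x
  change rawForm (lieD (fun p => X p + Y p) θ) x = rawForm (lieD X θ) x + rawForm (lieD Y θ) x
  rw [rawForm_lieD, rawForm_lieD, rawForm_lieD, ← lieDerivForm_add_field
    ((hX.contDiffAt hx).differentiableAt (by simp)) ((hY.contDiffAt hx).differentiableAt (by simp))]
  congr 1
  funext z
  exact map_add _ _ _

theorem lieD_smul {k : ℕ} (X : VField E P) {f : P → ℝ}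
    (hf : ContMDiff 𝓘(ℝ, E) 𝓘(ℝ, ℝ) ∞ f) {θ : DForm E P k} (hθ : IsSmoothForm θ) (x : P) :
    lieD X (fun p => f p • θ p) x = f x • lieD X θ x + dFun f x (X x) • θ x := by
  have hx := mem_extChartAt_target (I := 𝓘(ℝ, E)) x
  change rawForm (lieD X (fun p => f p • θ p)) x = f x • rawForm (lieD X θ) x +
    rawDiff f x (rawField X x) • rawForm θ x
  rw [rawForm_lieD, rawForm_lieD, rawDiff_eq_fderiv hf, ← chartVField_self, ← chartForm_self]
  refine (lieDerivForm_smul ((contDiffAt_chartFun hf hx).differentiableAt (by simp))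
    ((hθ.contDiffAt hx).differentiableAt (by simp))).trans ?_
  rw [Function.comp_apply, extChartAt_to_inv]

/-- `d(f θ) = df ∧ θ + f dθ`; only the existence of the first factor of `df ∧ θ` matters in what
follows. -/
theorem d_smul_one [FiniteDimensional ℝ E] {f : P → ℝ} (hf : ContMDiff 𝓘(ℝ, E) 𝓘(ℝ, ℝ) ∞ f)
    {θ : DForm E P 1} (hθ : IsSmoothForm θ) (x : P) :
    ∃ δ : TangentSpace 𝓘(ℝ, E) x [⋀^Fin 1]→L[ℝ] ℝ,
      d (fun p => f p • θ p : DForm E P 1) x = wedge δ (θ x) + f x • d θ x := by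
  have hx := mem_extChartAt_target (I := 𝓘(ℝ, E)) x
  refine ⟨(diffForm (f ∘ (extChartAt 𝓘(ℝ, E) x).symm) (extChartAt 𝓘(ℝ, E) x x) :), ?_⟩
  change rawForm (d (fun p => f p • θ p : DForm E P 1)) x =
    wedge (diffForm (f ∘ (extChartAt 𝓘(ℝ, E) x).symm) (extChartAt 𝓘(ℝ, E) x x)) (rawForm θ x) +
      f x • rawForm (d θ) x
  rw [rawForm_d, rawForm_d, ← chartForm_self]
  refine (extDeriv_smul_one ((contDiffAt_chartFun hf hx).differentiableAt (by simp))
    ((hθ.contDiffAt hx).differentiableAt (by simp))).trans ?_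
  rw [Function.comp_apply, extChartAt_to_inv]

theorem d_add {k : ℕ} {θ θ' : DForm E P k} (hθ : IsSmoothForm θ) (hθ' : IsSmoothForm θ') (x : P) :
    d (fun p => θ p + θ' p : DForm E P k) x = d θ x + d θ' x := by
  have hx := mem_extChartAt_target (I := 𝓘(ℝ, E)) x
  change rawForm (d (fun p => θ p + θ' p : DForm E P k)) x = rawForm (d θ) x + rawForm (d θ') x
  rw [rawForm_d, rawForm_d, rawForm_d]
  exact extDeriv_add ((hθ.contDiffAt hx).differentiableAt (by simp))
    ((hθ'.contDiffAt hx).differentiableAt (by simp))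

theorem d_neg {k : ℕ} (θ : DForm E P k) (x : P) :
    d (fun p => -θ p : DForm E P k) x = -d θ x := by
  change rawForm (d (fun p => -θ p : DForm E P k)) x = -rawForm (d θ) x
  rw [rawForm_d, rawForm_d]
  have h : chartForm x (fun p => -θ p : DForm E P k) = fun z => -chartForm x θ z := rfl
  rw [h, extDeriv, fderiv_fun_neg]
  exact map_neg (ContinuousAlternatingMap.alternatizeUncurryFinCLM ℝ E ℝ) _

end ManifoldCalculus

/-! ### Differentials of functions -/

section Functions

variable {E : Type*} [NormedAddCommGroup E] [NormedSpace ℝ E]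
  {P : Type*} [TopologicalSpace P] [ChartedSpace E P]

theorem flat_apply (η : DForm E P 1) (x : P) (v w : TangentSpace 𝓘(ℝ, E) x) :
    flat η x v w = d η x ![v, w] + oneForm (η x) v * oneForm (η x) w := rfl

theorem dFun_neg {f : P → ℝ} (x : P) (v : TangentSpace 𝓘(ℝ, E) x) :
    dFun (fun p => -f p) x v = -dFun f x v := by
  have h : mfderiv 𝓘(ℝ, E) 𝓘(ℝ, ℝ) (-f) x = -mfderiv 𝓘(ℝ, E) 𝓘(ℝ, ℝ) f x := mfderiv_neg
  exact congrArg (fun g : E →L[ℝ] ℝ => g v) h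

theorem contDiffOn_chart_oneForm {η : DForm E P 1} (hη : IsSmoothForm η) (a : P) (v : E) :
    ContDiffOn ℝ ∞ (fun y =>
      oneForm (η ((extChartAt 𝓘(ℝ, E) a).symm y)) (chartMap a y v))
      (extChartAt 𝓘(ℝ, E) a).target := by
  have h : ContDiffOn ℝ ∞ (fun y => chartForm a η y ![v]) (extChartAt 𝓘(ℝ, E) a).target :=
    (hη a).continuousLinearMap_comp (ContinuousAlternatingMap.apply ℝ E ℝ ![v])
  refine h.congr fun y _ => ?_
  refine (oneForm_apply _ _).trans ?_
  exact congrArg (rawForm η _) (funext fun i => by fin_cases i; rfl)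

/-- `d(1 / f) = -df / f ^ 2`. -/
theorem dFun_inv [IsManifold 𝓘(ℝ, E) ∞ P] {f : P → ℝ}
    (hf : ContMDiff 𝓘(ℝ, E) 𝓘(ℝ, ℝ) ∞ f) (h0 : ∀ x, f x ≠ 0)
    (hfi : ContMDiff 𝓘(ℝ, E) 𝓘(ℝ, ℝ) ∞ fun p => (f p)⁻¹) (x : P)
    (v : TangentSpace 𝓘(ℝ, E) x) :
    dFun (fun p => (f p)⁻¹) x v = -((f x)⁻¹ * (f x)⁻¹ * dFun f x v) := by
  have hx := mem_extChartAt_target (I := 𝓘(ℝ, E)) x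
  refine (rawDiff_eq_fderiv hfi x v).trans ?_
  have h1 := ((contDiffAt_chartFun hf hx).differentiableAt (by simp)).hasFDerivAt
  have h2 : dFun f x v = _ := rawDiff_eq_fderiv hf x v
  have h3 := (hasDerivAt_inv (h0 ((extChartAt 𝓘(ℝ, E) x).symm
    (extChartAt 𝓘(ℝ, E) x x)))).comp_hasFDerivAt (extChartAt 𝓘(ℝ, E) x x) h1
  refine (congrArg (fun L : E →L[ℝ] ℝ => L v) h3.fderiv).trans ?_
  rw [h2, extChartAt_to_inv]
  change -(f x ^ 2)⁻¹ * fderiv ℝ (f ∘ (extChartAt 𝓘(ℝ, E) x).symm) (extChartAt 𝓘(ℝ, E) x x) v = _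
  ring

end Functions

/-! ### The Reeb and Hamiltonian vector fields of a contact form -/

section Contact

variable {E : Type*} [NormedAddCommGroup E] [NormedSpace ℝ E] [FiniteDimensional ℝ E]
  {P : Type*} [TopologicalSpace P] [ChartedSpace E P] {n : ℕ} {η : DForm E P 1}

theorem IsContactForm.flat_bijective (hη : IsContactForm n η) (x : P) :
    Function.Bijective (flat η x) :=
  flatMap_bijective (V := E) (α := rawForm η x) (β := rawForm (d η) x) hη.finrank_eq
    (hη.volume_ne_zero x)

theorem IsContactForm.flat_sharp (hη : IsContactForm n η) (x : P)
    (φ : Module.Dual ℝ (TangentSpace 𝓘(ℝ, E) x)) : flat η x (sharp η x φ) = φ :=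
  Function.rightInverse_invFun (hη.flat_bijective x).2 φ

/-- The Reeb vector field satisfies `η(R) = 1` and `ι_R dη = 0`. -/
theorem IsContactForm.reeb_spec (hη : IsContactForm n η) (x : P) :
    oneForm (η x) (reeb η x) = 1 ∧ ∀ v, d η x ![reeb η x, v] = 0 := by
  -- as `ι_r dη = 0` forces `η(r) ≠ 0`, the Reeb vector is the normalized kernel vector of `dη`
  obtain ⟨r, hr, hker⟩ : ∃ r : TangentSpace 𝓘(ℝ, E) x, r ≠ 0 ∧ ∀ w, d η x ![r, w] = 0 :=
    exists_two_form_kernel (V := E) hη.finrank_eq (rawForm (d η) x)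
  have hr1 : oneForm (η x) r ≠ 0 := by
    intro h0
    refine hr ((injective_iff_map_eq_zero _).1 (hη.flat_bijective x).1 r ?_)
    ext v
    rw [flat_apply, hker, h0]
    simp
  have hR : reeb η x = (oneForm (η x) r)⁻¹ • r := by
    refine (hη.flat_bijective x).1 ((hη.flat_sharp x _).trans ?_)
    ext v
    rw [map_smul, LinearMap.smul_apply, flat_apply, hker, zero_add, smul_eq_mul,
      inv_mul_cancel_left₀ hr1]
  have h1 : oneForm (η x) (reeb η x) = 1 := by
    rw [hR, map_smul, smul_eq_mul, inv_mul_cancel₀ hr1]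
  refine ⟨h1, fun v => ?_⟩
  have h2 := LinearMap.congr_fun (hη.flat_sharp x (oneForm (η x))) v
  rw [flat_apply] at h2
  change d η x ![reeb η x, v] + oneForm (η x) (reeb η x) * _ = _ at h2
  rw [h1] at h2
  linarith

variable {H : P → ℝ}

theorem IsContactForm.flat_hamVField (hη : IsContactForm n η) (x : P)
    (v : TangentSpace 𝓘(ℝ, E) x) :
    d η x ![hamVField η H x, v] + oneForm (η x) (hamVField η H x) * oneForm (η x) v =
      dFun H x v - (dFun H x (reeb η x) + H x) * oneForm (η x) v :=
  LinearMap.congr_fun (hη.flat_sharp x (herglotzForm η H x)) v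

/-- `η(X_H) = -H`, by evaluating `♭(X_H)` at the Reeb vector field. -/
theorem IsContactForm.oneForm_hamVField (hη : IsContactForm n η) (x : P) :
    oneForm (η x) (hamVField η H x) = -H x := by
  obtain ⟨h1, h2⟩ := hη.reeb_spec x
  have h := hη.flat_hamVField (H := H) x (reeb η x)
  rw [two_form_swap, h2, h1] at h
  linarith

/-- `ι_{X_H} dη = dH - R(H) η`. -/
theorem IsContactForm.d_hamVField (hη : IsContactForm n η) (x : P)
    (v : TangentSpace 𝓘(ℝ, E) x) :
    d η x ![hamVField η H x, v] = dFun H x v - dFun H x (reeb η x) * oneForm (η x) v := by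
  have h := hη.flat_hamVField (H := H) x v
  rw [hη.oneForm_hamVField] at h
  linarith

/-- `X_H(H) = -R(H) H`, by evaluating `ι_{X_H} dη` at `X_H`. -/
theorem IsContactForm.dFun_hamVField (hη : IsContactForm n η) (x : P) :
    dFun H x (hamVField η H x) = -(dFun H x (reeb η x) * H x) := by
  have h := hη.d_hamVField (H := H) x (hamVField η H x)
  rw [two_form_self, hη.oneForm_hamVField] at h
  linarith

variable [IsManifold 𝓘(ℝ, E) ∞ P]

/-- A vector field `V` is smooth as soon as the one-form `♭(V)` is: in a chart, `V` is obtained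
from that one-form by inverting a smooth family of linear maps. -/
theorem IsContactForm.isSmoothVField_of_flat (hη : IsContactForm n η) {V : VField E P}
    (hV : ∀ (a : P) (v : E), ContDiffOn ℝ ∞ (fun y =>
      flat η ((extChartAt 𝓘(ℝ, E) a).symm y) (V ((extChartAt 𝓘(ℝ, E) a).symm y)) (chartMap a y v))
      (extChartAt 𝓘(ℝ, E) a).target) : IsSmoothVField V := by
  refine isSmoothVField_of_contDiffAt fun a => ?_
  set T := (extChartAt 𝓘(ℝ, E) a).target with hT
  have hTo : IsOpen T := isOpen_extChartAt_target a
  have hy₀ : extChartAt 𝓘(ℝ, E) a a ∈ T := mem_extChartAt_target a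
  -- `A` is `♭` in coordinates, and `c` is the coordinate expression of `♭(V)`
  let A : E → E →L[ℝ] E →L[ℝ] ℝ := fun y =>
    (flatMap (chartForm a η y) (extDeriv (chartForm a η) y)).toContinuousBilinearMap
  have hA (y v w : E) : A y v w = extDeriv (chartForm a η) y ![v, w] +
      chartForm a η y ![v] * chartForm a η y ![w] := by
    rw [← oneForm_apply, ← oneForm_apply]
    rfl
  have hpull (y : E) (hy : y ∈ T) (v w : E) : A y v w =
      flat η ((extChartAt 𝓘(ℝ, E) a).symm y) (chartMap a y v) (chartMap a y w) := by
    have e1 (u : E) : chartForm a η y ![u] =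
        oneForm (η ((extChartAt 𝓘(ℝ, E) a).symm y)) (chartMap a y u) := by
      refine Eq.trans ?_ (oneForm_apply _ _).symm
      exact congrArg (rawForm η _) (funext fun i => by fin_cases i; rfl)
    have e2 : extDeriv (chartForm a η) y ![v, w] =
        d η ((extChartAt 𝓘(ℝ, E) a).symm y) ![chartMap a y v, chartMap a y w] := by
      rw [← chartForm_d hη.smooth hy]
      exact congrArg (rawForm (d η) _) (funext fun i => by fin_cases i <;> rfl)
    refine (hA y v w).trans ?_
    rw [e1, e1, e2]
    rfl
  let c : E → E →L[ℝ] ℝ := fun y => A y (chartVField a V y)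
  have hc (y : E) (hy : y ∈ T) (v : E) : c y v = flat η ((extChartAt 𝓘(ℝ, E) a).symm y)
      (V ((extChartAt 𝓘(ℝ, E) a).symm y)) (chartMap a y v) := by
    have h := hpull y hy (chartVField a V y) v
    rw [chartMap_chartVField hy] at h
    exact h
  have hcs : ContDiffOn ℝ ∞ c T :=
    contDiffOn_clm_apply.2 fun v => (hV a v).congr fun y hy => hc y hy v
  have hconst {k : ℕ} {β : E → E [⋀^Fin k]→L[ℝ] ℝ} (hβ : ContDiffOn ℝ ∞ β T) (m : Fin k → E) :
      ContDiffOn ℝ ∞ (fun y => β y m) T :=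
    hβ.continuousLinearMap_comp (ContinuousAlternatingMap.apply ℝ E ℝ m)
  have hds : ContDiffOn ℝ ∞ (extDeriv (chartForm a η)) T := fun y hy =>
    (contDiffAt_extDeriv (hη.smooth.contDiffAt hy)).contDiffWithinAt
  have hAs : ContDiffOn ℝ ∞ A T := by
    refine contDiffOn_clm_apply.2 fun v => contDiffOn_clm_apply.2 fun w => ?_
    simp only [hA]
    exact (hconst hds _).add ((hconst (hη.smooth a) _).mul (hconst (hη.smooth a) _))
  have hbij (y : E) (hy : y ∈ T) : Function.Bijective (A y) := by
    have hinj : Function.Injective (A y) := by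
      refine (injective_iff_map_eq_zero _).2 fun v hv => ?_
      refine (injective_iff_map_eq_zero (chartMap a y)).1 (chartMap_bijective hy).1 v ?_
      refine (injective_iff_map_eq_zero _).1 (hη.flat_bijective ((extChartAt 𝓘(ℝ, E) a).symm y)).1
        _ ?_
      ext w
      obtain ⟨w', hw'⟩ := (chartMap_bijective hy).2 w
      have h := hpull y hy v w'
      rw [hv, hw'] at h
      exact h.symm
    refine ⟨hinj, ?_⟩
    have hfr : Module.finrank ℝ E = Module.finrank ℝ (E →L[ℝ] ℝ) := by
      rw [← (LinearMap.toContinuousLinearMap (𝕜 := ℝ) (E := E) (F' := ℝ)).finrank_eq]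
      exact (Subspace.dual_finrank_eq (K := ℝ) (V := E)).symm
    exact (LinearMap.injective_iff_surjective_of_finrank_eq_finrank (f := (A y).toLinearMap)
      hfr).1 hinj
  let e (y : E) (hy : y ∈ T) : E ≃L[ℝ] (E →L[ℝ] ℝ) :=
    (LinearEquiv.ofBijective (A y).toLinearMap (hbij y hy)).toContinuousLinearEquiv
  have he (y : E) (hy : y ∈ T) : (e y hy : E →L[ℝ] (E →L[ℝ] ℝ)) = A y := by
    ext v : 1
    rfl
  have hinv : ContDiffAt ℝ ∞ (fun y => (A y).inverse (c y)) (extChartAt 𝓘(ℝ, E) a a) := by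
    have hmap := contDiffAt_map_inverse (n := ∞) (e _ hy₀)
    rw [he _ hy₀] at hmap
    exact (hmap.comp _ (hAs.contDiffAt (hTo.mem_nhds hy₀))).clm_apply
      (hcs.contDiffAt (hTo.mem_nhds hy₀))
  refine hinv.congr_of_eventuallyEq ?_
  filter_upwards [hTo.mem_nhds hy₀] with y hy
  change _ = (A y).inverse (A y (chartVField a V y))
  rw [← he y hy, ContinuousLinearMap.inverse_equiv]
  exact ((e y hy).symm_apply_apply _).symm

theorem IsContactForm.isSmoothVField_reeb (hη : IsContactForm n η) : IsSmoothVField (reeb η) := by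
  refine hη.isSmoothVField_of_flat fun a v => ?_
  refine (contDiffOn_chart_oneForm hη.smooth a v).congr fun y _ => ?_
  exact LinearMap.congr_fun (hη.flat_sharp _ _) _

theorem IsContactForm.isSmoothVField_hamVField (hη : IsContactForm n η)
    (hH : ContMDiff 𝓘(ℝ, E) 𝓘(ℝ, ℝ) ∞ H) : IsSmoothVField (hamVField η H) := by
  refine hη.isSmoothVField_of_flat fun a v => ?_
  have hRH : ContMDiff 𝓘(ℝ, E) 𝓘(ℝ, ℝ) ∞ (fun x => dFun H x (reeb η x) + H x) :=
    (contMDiff_dFun_apply hH hη.isSmoothVField_reeb).add hH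
  have h1 : ContDiffOn ℝ ∞ (fun y => fderiv ℝ (H ∘ (extChartAt 𝓘(ℝ, E) a).symm) y v)
      (extChartAt 𝓘(ℝ, E) a).target := fun y hy =>
    (((contDiffAt_chartFun hH hy).fderiv_right (m := ∞) (by simp)).clm_apply
      contDiffAt_const).contDiffWithinAt
  have h2 : ContDiffOn ℝ ∞ ((fun x => dFun H x (reeb η x) + H x) ∘ (extChartAt 𝓘(ℝ, E) a).symm)
      (extChartAt 𝓘(ℝ, E) a).target := fun y hy =>
    (contDiffAt_chartFun hRH hy).contDiffWithinAt
  refine (h1.sub (h2.mul (contDiffOn_chart_oneForm hη.smooth a v))).congr fun y hy => ?_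
  refine (LinearMap.congr_fun (hη.flat_sharp _ _) _).trans ?_
  rw [fderiv_chartFun hH hy]
  rfl

/-- `L_{X_H} η = -R(H) η`. -/
theorem IsContactForm.lieD_hamVField (hη : IsContactForm n η)
    (hH : ContMDiff 𝓘(ℝ, E) 𝓘(ℝ, ℝ) ∞ H) (x : P) :
    lieD (hamVField η H) η x = -(dFun H x (reeb η x) • η x) := by
  refine oneForm_ext fun v => ?_
  have hf : (fun p => oneForm (η p) (hamVField η H p)) = fun p => -H p :=
    funext fun p => hη.oneForm_hamVField p
  rw [lieD_one_eq_cartan (hη.isSmoothVField_hamVField hH) hη.smooth, hη.d_hamVField, hf, dFun_neg]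
  change _ = -(dFun H x (reeb η x) * oneForm (η x) v)
  ring

/-- If `H` has no zeros, then the Hamiltonian vector field preserves `η / H`. -/
theorem IsContactForm.lieD_hamVField_inv_smul (hη : IsContactForm n η)
    (hH : ContMDiff 𝓘(ℝ, E) 𝓘(ℝ, ℝ) ∞ H) (h0 : ∀ x, H x ≠ 0)
    (hHi : ContMDiff 𝓘(ℝ, E) 𝓘(ℝ, ℝ) ∞ fun p => (H p)⁻¹) (x : P) :
    lieD (hamVField η H) (fun p => (H p)⁻¹ • η p : DForm E P 1) x = 0 := by
  rw [lieD_smul _ hHi hη.smooth, hη.lieD_hamVField hH, dFun_inv hH h0 hHi, hη.dFun_hamVField]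
  have := h0 x
  refine oneForm_ext fun v => ?_
  change (H x)⁻¹ * -(dFun H x (reeb η x) * oneForm (η x) v) +
    -((H x)⁻¹ * (H x)⁻¹ * -(dFun H x (reeb η x) * H x)) * oneForm (η x) v = 0
  field_simp
  ring

end Contact

/-! ### Tangent spaces of submanifolds -/

section Submanifold

variable {E : Type*} [NormedAddCommGroup E] [NormedSpace ℝ E]
  {P : Type*} [TopologicalSpace P] [ChartedSpace E P]
  {E' : Type*} [NormedAddCommGroup E'] [NormedSpace ℝ E']
  {M : Type*} [TopologicalSpace M] [ChartedSpace E' M]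

/-- The derivative of an immersion is injective: in suitable charts the immersion has a smooth left
inverse. -/
theorem mfderiv_injective_of_isImmersionAt {ι : M → P} {m : M}
    (h : Manifold.IsImmersionAt 𝓘(ℝ, E') 𝓘(ℝ, E) ∞ ι m) :
    Function.Injective (mfderiv 𝓘(ℝ, E') 𝓘(ℝ, E) ι m) := by
  set c := h.domChart.extend 𝓘(ℝ, E') with hc
  set b := h.codChart.extend 𝓘(ℝ, E) with hb
  have hm : m ∈ h.domChart.source := h.mem_domChart_source
  -- in the given charts `ι` is `u ↦ (u, 0)`, so that the first projection inverts it
  let g : P → M := c.symm ∘ (fun v => (h.equiv.symm v).1) ∘ b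
  have hgι : ∀ q ∈ h.domChart.source, g (ι q) = q := by
    intro q hq
    have hqs : q ∈ c.source := by rwa [hc, OpenPartialHomeomorph.extend_source]
    have h1 := h.writtenInCharts (c.map_source hqs)
    simp only [Function.comp_apply] at h1
    rw [← hc, ← hb, c.left_inv hqs] at h1
    simp only [g, Function.comp_apply, h1, ContinuousLinearEquiv.symm_apply_apply]
    exact c.left_inv hqs
  have hιd : MDifferentiableAt 𝓘(ℝ, E') 𝓘(ℝ, E) ι m := h.contMDiffAt.mdifferentiableAt (by simp)
  have hbd : ContMDiffAt 𝓘(ℝ, E) 𝓘(ℝ, E) ∞ b (ι m) :=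
    h.codChart.contMDiffAt_extend h.codChart_mem_maximalAtlas h.mem_codChart_source
  have hgd : MDifferentiableAt 𝓘(ℝ, E) 𝓘(ℝ, E') g (ι m) := by
    have hmid : ContMDiffAt 𝓘(ℝ, E) 𝓘(ℝ, E') ∞
        (fun v => (h.equiv.symm v).1) (b (ι m)) :=
      contMDiffAt_iff_contDiffAt.2 (((ContinuousLinearMap.fst ℝ E' h.complement).comp
        (h.equiv.symm : E →L[ℝ] _)).contDiff.contDiffAt)
    have hpt : (h.equiv.symm (b (ι m))).1 = c m := by
      have hms : m ∈ c.source := by rwa [hc, OpenPartialHomeomorph.extend_source]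
      have h1 := h.writtenInCharts (c.map_source hms)
      simp only [Function.comp_apply] at h1
      rw [← hc, ← hb, c.left_inv hms] at h1
      rw [h1, ContinuousLinearEquiv.symm_apply_apply]
    have hcs : ContMDiffAt 𝓘(ℝ, E') 𝓘(ℝ, E') ∞ c.symm (c m) := by
      refine (contMDiffOn_extend_symm h.domChart_mem_maximalAtlas).contMDiffAt ?_
      refine Filter.mem_of_superset (h.domChart.open_target.mem_nhds (h.domChart.map_source hm)) ?_
      exact fun z hz => ⟨z, hz, rfl⟩
    refine ContMDiffAt.mdifferentiableAt (n := ∞) ?_ (by simp)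
    refine ContMDiffAt.comp (ι m) ?_ (ContMDiffAt.comp (ι m) hmid hbd)
    rw [Function.comp_apply, hpt]
    exact hcs
  have hcomp := mfderiv_comp m hgd hιd
  have hid : mfderiv 𝓘(ℝ, E') 𝓘(ℝ, E') (g ∘ ι) m =
      mfderiv 𝓘(ℝ, E') 𝓘(ℝ, E') id m := by
    refine Filter.EventuallyEq.mfderiv_eq ?_
    filter_upwards [h.domChart.open_source.mem_nhds hm] with q hq
    exact hgι q hq
  rw [mfderiv_id] at hid
  intro u v huv
  have happ (w : E') : (w : E') = mfderiv 𝓘(ℝ, E) 𝓘(ℝ, E') g (ι m)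
      (mfderiv 𝓘(ℝ, E') 𝓘(ℝ, E) ι m w) :=
    (congrArg (fun L : E' →L[ℝ] E' => L w) (hcomp.symm.trans hid)).symm
  exact (happ u).trans ((congrArg _ huv).trans (happ v).symm)

/-- Two functions which agree on a submanifold have the same differential along its tangent
spaces. -/
theorem dFun_eq_of_eqOn_range {f g : P → ℝ} {ι : M → P} (hf : ContMDiff 𝓘(ℝ, E) 𝓘(ℝ, ℝ) ∞ f)
    (hg : ContMDiff 𝓘(ℝ, E) 𝓘(ℝ, ℝ) ∞ g) (hι : ContMDiff 𝓘(ℝ, E') 𝓘(ℝ, E) ∞ ι)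
    (hfg : ∀ m, f (ι m) = g (ι m)) (m : M) (u : TangentSpace 𝓘(ℝ, E') m) :
    dFun f (ι m) (mfderiv 𝓘(ℝ, E') 𝓘(ℝ, E) ι m u) =
      dFun g (ι m) (mfderiv 𝓘(ℝ, E') 𝓘(ℝ, E) ι m u) := by
  have h1 := mfderiv_comp m (hf.mdifferentiableAt (by simp)) (hι.mdifferentiableAt (by simp))
  have h2 := mfderiv_comp m (hg.mdifferentiableAt (by simp)) (hι.mdifferentiableAt (by simp))
  have h3 : f ∘ ι = g ∘ ι := funext hfg
  rw [h3, h2] at h1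
  exact (congrArg (fun L : E' →L[ℝ] ℝ => L u) h1).symm

end Submanifold

/-! ### The dimension count for the splitting -/

section Dimension

variable {V : Type*} [AddCommGroup V] [Module ℝ V] [FiniteDimensional ℝ V]

/-- The dimension count behind the splitting: if `b` is bijective, then `b⁻¹(F°)` has dimension
`dim V - dim F`. -/
theorem isCompl_comap_dualAnnihilator {b : V →ₗ[ℝ] Module.Dual ℝ V} (hb : Function.Bijective b)
    {F T : Submodule ℝ V} (hdisj : F.dualAnnihilator.comap b ⊓ T = ⊥)
    (hFT : Module.finrank ℝ F = Module.finrank ℝ T) : IsCompl (F.dualAnnihilator.comap b) T := by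
  refine ⟨disjoint_iff.2 hdisj, codisjoint_iff.2 (Submodule.eq_top_of_finrank_eq ?_)⟩
  let e := LinearEquiv.ofBijective b hb
  have h1 : Module.finrank ℝ (F.dualAnnihilator.comap b) = Module.finrank ℝ F.dualAnnihilator := by
    have h : F.dualAnnihilator.comap b = F.dualAnnihilator.map (e.symm : _ →ₗ[ℝ] V) :=
      Submodule.comap_equiv_eq_map_symm e _
    rw [h]
    exact LinearEquiv.finrank_map_eq e.symm _
  have h2 := Subspace.finrank_add_finrank_dualAnnihilator_eq F
  have h3 := Submodule.finrank_sup_add_finrank_inf_eq (F.dualAnnihilator.comap b) T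
  rw [hdisj, finrank_bot] at h3
  omega

end Dimension

/-! ### Lie derivatives of contact volumes -/

section VectorFields

variable {E : Type*} [NormedAddCommGroup E] [NormedSpace ℝ E]
  {P : Type*} [TopologicalSpace P] [ChartedSpace E P] [IsManifold 𝓘(ℝ, E) ∞ P]
  {X Z : VField E P}

theorem lieD_add_lieD_of_eventually (hX : IsSmoothVField X) (hZ : IsSmoothVField Z) {x : P}
    {Y : VField E P} (h : ∀ᶠ p in 𝓝 x, X p + Z p = Y p) {k : ℕ} (θ : DForm E P k) :
    lieD X θ x + lieD Z θ x = lieD Y θ x := by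
  rw [← lieD_add_field hX hZ θ x]
  exact lieD_congr h

end VectorFields

section LieDerivatives

variable {E : Type*} [NormedAddCommGroup E] [NormedSpace ℝ E] [FiniteDimensional ℝ E]
  {P : Type*} [TopologicalSpace P] [ChartedSpace E P] [IsManifold 𝓘(ℝ, E) ∞ P] {n : ℕ}

/-- If `L_X θ = -f θ - τ` near `x`, the Leibniz rule turns this into a formula for the Lie
derivative of `θ ∧ (dθ) ^ n`; the term `df ∧ θ` of `d(f θ)` is killed by the factor `θ`. -/
theorem lieD_volumeForm_of_eventually {X : VField E P} (hX : IsSmoothVField X)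
    {θ τ : DForm E P 1} (hθ : IsSmoothForm θ) (hτ : IsSmoothForm τ) {f : P → ℝ}
    (hf : ContMDiff 𝓘(ℝ, E) 𝓘(ℝ, ℝ) ∞ f) {x : P}
    (h : ∀ᶠ p in 𝓝 x, lieD X θ p = -(f p • θ p) - τ p) :
    lieD X (volumeForm n θ) x = -(((n + 1 : ℝ) * f x) • volumeForm n θ x)
      - wedge (τ x) (wedgePow (d θ x) n) - wedgeCross (θ x) (d θ x) (d τ x) n := by
  obtain ⟨δ, hδ⟩ := d_smul_one hf hθ x
  have hd : d (lieD X θ) x = -(wedge δ (θ x) + f x • d θ x + d τ x) := by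
    have h' : ∀ᶠ p in 𝓝 x, lieD X θ p = -(f p • θ p + τ p) := by
      filter_upwards [h] with p hp
      rw [hp]
      abel
    rw [d_congr (θ' := fun p => -(f p • θ p + τ p)) h',
      d_neg (fun p => f p • θ p + τ p : DForm E P 1), d_add (hθ.smul hf) hτ, hδ]
  rw [lieD_volumeForm hX hθ, hd, h.self_of_nhds, sub_eq_add_neg, wedge_add_left, wedge_neg_left,
    wedge_smul_left, wedge_neg_left, wedgeCross_neg, wedgeCross_add, wedgeCross_add,
    wedgeCross_wedge_self, wedgeCross_smul, wedgeCross_self, zero_add]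
  rw [volumeForm]
  module

variable {η : DForm E P 1} {H : P → ℝ}

theorem IsContactForm.contMDiff_reeb_apply (hη : IsContactForm n η)
    (hH : ContMDiff 𝓘(ℝ, E) 𝓘(ℝ, ℝ) ∞ H) :
    ContMDiff 𝓘(ℝ, E) 𝓘(ℝ, ℝ) ∞ (fun x => dFun H x (reeb η x)) :=
  contMDiff_dFun_apply hH hη.isSmoothVField_reeb

end LieDerivatives

/-! ### Constrained Hamiltonian systems -/

namespace ConstrainedHamiltonianSystem

section System

variable {n : ℕ}
    {E : Type*} [NormedAddCommGroup E] [NormedSpace ℝ E]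
    {P : Type*} [TopologicalSpace P] [ChartedSpace E P] [IsManifold 𝓘(ℝ, E) ∞ P]
    {E' : Type*} [NormedAddCommGroup E'] [NormedSpace ℝ E']
    {M : Type*} [TopologicalSpace M] [ChartedSpace E' M]
    (S : ConstrainedHamiltonianSystem E P E' M n)

theorem finrank_TM (m : M) : Module.finrank ℝ (S.TM m) = Module.finrank ℝ E' :=
  LinearMap.finrank_range_of_inj (M := E')
    (mfderiv_injective_of_isImmersionAt (S.embedding.isImmersion.isImmersionAt m))

theorem finrank_F (m : M) : Module.finrank ℝ (S.F m) = S.rankF := by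
  obtain ⟨U, hU, s, -, hs⟩ := S.regular_F m
  obtain ⟨hli, hspan⟩ := hs m (mem_of_mem_nhds hU)
  rw [← hspan, finrank_span_eq_card hli, Fintype.card_fin]

theorem isCompl_orthL_TM [FiniteDimensional ℝ E] (huniq : ∀ m, S.orthL m ⊓ S.TM m = ⊥)
    (hrank : S.rankF = Module.finrank ℝ E') (m : M) : IsCompl (S.orthL m) (S.TM m) := by
  -- the tangent space is replaced by `E`, whose finite dimension is known to instance search
  have key := @isCompl_comap_dualAnnihilator E _ _ _
  exact key (S.contact.flat_bijective (S.ι m)) (huniq m)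
    ((S.finrank_F m).trans (hrank.trans (S.finrank_TM m).symm))

variable {S} in
theorem dFun_eq_zero_of_mem_orthL (hmech : S.MechanicalCondition) {m : M}
    {v : TangentSpace 𝓘(ℝ, E) (S.ι m)} (hv : v ∈ S.orthL m) : dFun S.H (S.ι m) v = 0 :=
  (Submodule.mem_dualAnnihilator _).1 (hmech m) v hv

theorem isSmoothForm_ηTilde (h0 : ∀ x, S.H x ≠ 0) : IsSmoothForm S.ηTilde :=
  S.contact.smooth.smul (S.smooth_H.inv₀ h0)

variable {S} in
theorem lieD_ηTilde (h0 : ∀ x, S.H x ≠ 0) (Y : VField E P) (x : P) :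
    lieD Y S.ηTilde x = (S.H x)⁻¹ • lieD Y S.η x +
      (-((S.H x)⁻¹ * (S.H x)⁻¹ * dFun S.H x (Y x))) • S.η x := by
  rw [← dFun_inv S.smooth_H h0 (S.smooth_H.inv₀ h0)]
  exact lieD_smul Y (S.smooth_H.inv₀ h0) S.contact.smooth x

end System

section Solution

variable {n : ℕ}
    {E : Type*} [NormedAddCommGroup E] [NormedSpace ℝ E] [FiniteDimensional ℝ E]
    {P : Type*} [TopologicalSpace P] [ChartedSpace E P] [IsManifold 𝓘(ℝ, E) ∞ P]
    {E' : Type*} [NormedAddCommGroup E'] [NormedSpace ℝ E']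
    {M : Type*} [TopologicalSpace M] [ChartedSpace E' M]
    {S : ConstrainedHamiltonianSystem E P E' M n} {X Z : VField E P}

/-- The constrained Herglotz equation says that `♭(X) - ♭(X_H)` lies in `F°`. -/
theorem SolvesConstrainedHerglotz.sub_mem_orthL (hX : S.SolvesConstrainedHerglotz X) (m : M) :
    S.XH (S.ι m) - X (S.ι m) ∈ S.orthL m := by
  have h := hX.equation m
  have hs : flat S.η (S.ι m) (S.XH (S.ι m)) = herglotzForm S.η S.H (S.ι m) :=
    S.contact.flat_sharp _ _
  change flat S.η (S.ι m) (S.XH (S.ι m) - X (S.ι m)) ∈ (S.F m).dualAnnihilator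
  have h' := (S.F m).dualAnnihilator.neg_mem h
  convert h' using 1
  rw [map_sub, hs, herglotzForm, RH, R, add_comm (S.H _)]
  abel

theorem SolvesConstrainedHerglotz.projP_eq (hX : S.SolvesConstrainedHerglotz X) {m : M}
    (h : IsCompl (S.orthL m) (S.TM m)) : S.projP m (S.XH (S.ι m)) = X (S.ι m) := by
  rw [projP, dif_pos h]
  have h1 := Submodule.projection_apply_of_mem_left h.symm (hX.tangent m)
  have h2 := (Submodule.projection_apply_eq_zero_iff h.symm).2 (hX.sub_mem_orthL m)
  rw [map_sub, sub_eq_zero] at h2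
  exact h2.trans h1

theorem SolvesConstrainedHerglotz.projQ_eq (hX : S.SolvesConstrainedHerglotz X) {m : M}
    (h : IsCompl (S.orthL m) (S.TM m)) :
    S.projQ m (S.XH (S.ι m)) = S.XH (S.ι m) - X (S.ι m) := by
  rw [projQ, dif_pos h]
  have h1 := Submodule.projection_apply_of_mem_left h (hX.sub_mem_orthL m)
  have h2 := (Submodule.projection_apply_eq_zero_iff h).2 (hX.tangent m)
  rw [map_sub, h2, sub_zero] at h1
  exact h1

end Solution

end ConstrainedHamiltonianSystem

/-! ### Lie derivatives of one-forms along submanifolds and horizontal fields -/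

section Restriction

variable {E : Type*} [NormedAddCommGroup E] [NormedSpace ℝ E] [FiniteDimensional ℝ E]
  {P : Type*} [TopologicalSpace P] [ChartedSpace E P] [IsManifold 𝓘(ℝ, E) ∞ P]
  {E' : Type*} [NormedAddCommGroup E'] [NormedSpace ℝ E']
  {M : Type*} [TopologicalSpace M] [ChartedSpace E' M]

/-- On vectors tangent to a submanifold, `L_X θ` depends only on the values of `X` along the
submanifold, by Cartan's formula. -/
theorem lieD_one_apply_eq_of_eqOn_range {X Y : VField E P} (hX : IsSmoothVField X)
    (hY : IsSmoothVField Y) {θ : DForm E P 1} (hθ : IsSmoothForm θ) {ι : M → P}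
    (hι : ContMDiff 𝓘(ℝ, E') 𝓘(ℝ, E) ∞ ι) (hXY : ∀ m, X (ι m) = Y (ι m)) (m : M)
    (u : TangentSpace 𝓘(ℝ, E') m) :
    oneForm (lieD X θ (ι m)) (mfderiv 𝓘(ℝ, E') 𝓘(ℝ, E) ι m u) =
      oneForm (lieD Y θ (ι m)) (mfderiv 𝓘(ℝ, E') 𝓘(ℝ, E) ι m u) := by
  rw [lieD_one_eq_cartan hX hθ, lieD_one_eq_cartan hY hθ, hXY]
  exact congrArg (_ + ·) (dFun_eq_of_eqOn_range (contMDiff_pairing hθ hX)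
    (contMDiff_pairing hθ hY) hι (fun q => by rw [hXY]) m u)

end Restriction

section Horizontal

variable {E : Type*} [NormedAddCommGroup E] [NormedSpace ℝ E] [FiniteDimensional ℝ E]
  {P : Type*} [TopologicalSpace P] [ChartedSpace E P] [IsManifold 𝓘(ℝ, E) ∞ P]
  {Z : VField E P} {θ : DForm E P 1} {x : P}

/-- If `θ(Z) = 0` near `x`, then `L_Z θ = ι_Z dθ` at `x`. -/
theorem lieD_one_apply_of_horizontal (hZ : IsSmoothVField Z) (hθ : IsSmoothForm θ)
    (h : ∀ᶠ p in 𝓝 x, oneForm (θ p) (Z p) = 0) (v : TangentSpace 𝓘(ℝ, E) x) :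
    oneForm (lieD Z θ x) v = d θ x ![Z x, v] := by
  have h1 : mfderiv 𝓘(ℝ, E) 𝓘(ℝ, ℝ) (fun p => oneForm (θ p) (Z p)) x = _ :=
    Filter.EventuallyEq.mfderiv_eq (f := fun _ => (0 : ℝ)) h
  have h2 : dFun (fun p => oneForm (θ p) (Z p)) x v = 0 := by
    rw [mfderiv_const] at h1
    exact congrArg (fun L : E →L[ℝ] ℝ => L v) h1
  rw [lieD_one_eq_cartan hZ hθ, h2, add_zero]

/-- If `θ(Z) = 0` near `x`, then `L_Z θ ∧ (dθ) ^ n = ι_Z dθ ∧ (dθ) ^ n` at `x`, a top-degree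
form annihilated by the kernel of `dθ`, hence zero. -/
theorem wedge_lieD_wedgePow_of_horizontal {n : ℕ} (hn : Module.finrank ℝ E = 2 * n + 1)
    (hZ : IsSmoothVField Z) (hθ : IsSmoothForm θ) (h : ∀ᶠ p in 𝓝 x, oneForm (θ p) (Z p) = 0) :
    wedge (lieD Z θ x) (wedgePow (d θ x) n) = 0 :=
  wedge_wedgePow_eq_zero_of_contraction (V := E) hn (rawForm (d θ) x) (rawForm (lieD Z θ) x)
    (rawField Z x) (lieD_one_apply_of_horizontal hZ hθ h)

end Horizontal

/-! ### Evolution of the contact form and of the volumes along solutions -/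

namespace ConstrainedHamiltonianSystem

variable {n : ℕ}
    {E : Type*} [NormedAddCommGroup E] [NormedSpace ℝ E] [FiniteDimensional ℝ E]
    {P : Type*} [TopologicalSpace P] [ChartedSpace E P] [IsManifold 𝓘(ℝ, E) ∞ P]
    {E' : Type*} [NormedAddCommGroup E'] [NormedSpace ℝ E']
    {M : Type*} [TopologicalSpace M] [ChartedSpace E' M]
    {S : ConstrainedHamiltonianSystem E P E' M n} {X Z : VField E P}

variable (S) in
theorem isSmoothVField_XH : IsSmoothVField S.XH :=
  S.contact.isSmoothVField_hamVField S.smooth_H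

theorem SolvesConstrainedHerglotz.extendsQXH (hX : S.SolvesConstrainedHerglotz X)
    (hc : ∀ m, IsCompl (S.orthL m) (S.TM m)) : S.ExtendsQXH fun x => S.XH x - X x :=
  ⟨S.isSmoothVField_XH.sub hX.smooth, fun m => (hX.projQ_eq (hc m)).symm⟩

theorem SolvesConstrainedHerglotz.add_eq (hX : S.SolvesConstrainedHerglotz X)
    (hc : ∀ m, IsCompl (S.orthL m) (S.TM m)) (hZ : S.ExtendsQXH Z) (m : M) :
    X (S.ι m) + Z (S.ι m) = S.XH (S.ι m) := by
  rw [hZ.eq_on, hX.projQ_eq (hc m), add_sub_cancel]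

theorem ExtendsQXH.mem_orthL (hZ : S.ExtendsQXH Z) (hX : S.SolvesConstrainedHerglotz X)
    (hc : ∀ m, IsCompl (S.orthL m) (S.TM m)) (m : M) : Z (S.ι m) ∈ S.orthL m := by
  rw [hZ.eq_on, hX.projQ_eq (hc m)]
  exact hX.sub_mem_orthL m

/-- Along `M`, the energy dissipates as in the unconstrained system: the constraint force does no
work. -/
theorem SolvesConstrainedHerglotz.dFun_apply (hX : S.SolvesConstrainedHerglotz X)
    (hmech : S.MechanicalCondition) (m : M) :
    dFun S.H (S.ι m) (X (S.ι m)) = -(S.RH (S.ι m) * S.H (S.ι m)) := by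
  have h := dFun_eq_zero_of_mem_orthL hmech (hX.sub_mem_orthL m)
  have h' : dFun S.H (S.ι m) (S.XH (S.ι m)) = _ := S.contact.dFun_hamVField (S.ι m)
  rw [map_sub, h'] at h
  exact (sub_eq_zero.1 h).symm

theorem SolvesConstrainedHerglotz.energy (hX : S.SolvesConstrainedHerglotz X)
    (hmech : S.MechanicalCondition) (hc : ∀ m, IsCompl (S.orthL m) (S.TM m)) (m : M) :
    dFun S.H (S.ι m) (X (S.ι m)) =
      -(S.RH (S.ι m) * S.H (S.ι m)) - dFun S.H (S.ι m) (S.projQ m (S.XH (S.ι m))) := by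
  rw [hX.dFun_apply hmech, hX.projQ_eq (hc m),
    dFun_eq_zero_of_mem_orthL hmech (hX.sub_mem_orthL m), sub_zero]

variable (S) in
theorem contMDiff_RH : ContMDiff 𝓘(ℝ, E) 𝓘(ℝ, ℝ) ∞ S.RH :=
  S.contact.contMDiff_reeb_apply S.smooth_H

/-- On vectors tangent to `M`, `L_X η + L_Z η = L_{X_H} η`: the fields `X + Z` and `X_H` agree along
`M`. -/
theorem SolvesConstrainedHerglotz.lieD_apply (hX : S.SolvesConstrainedHerglotz X)
    (hc : ∀ m, IsCompl (S.orthL m) (S.TM m)) (hZ : S.ExtendsQXH Z) (m : M)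
    {v : TangentSpace 𝓘(ℝ, E) (S.ι m)} (hv : v ∈ S.TM m) :
    oneForm (lieD X S.η (S.ι m)) v =
      -(S.RH (S.ι m) * oneForm (S.η (S.ι m)) v) - oneForm (lieD Z S.η (S.ι m)) v := by
  obtain ⟨u, rfl⟩ := hv
  have h := lieD_one_apply_eq_of_eqOn_range (hX.smooth.add hZ.smooth) S.isSmoothVField_XH
    S.contact.smooth S.embedding.contMDiff (hX.add_eq hc hZ) m u
  rw [lieD_add_field hX.smooth hZ.smooth, XH, S.contact.lieD_hamVField S.smooth_H] at h
  exact eq_sub_of_add_eq h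

/-- `L_X η = -R(H) η - L_Z η` near `M`, from `L_{X_H} η = -R(H) η`. -/
theorem SplitsXHNear.lieD_eventually (hS : S.SplitsXHNear X Z) (hX : IsSmoothVField X)
    (hZ : IsSmoothVField Z) (m : M) :
    ∀ᶠ p in 𝓝 (S.ι m), lieD X S.η p = -(S.RH p • S.η p) - lieD Z S.η p := by
  filter_upwards [(hS m).eventually_nhds] with p hp
  rw [eq_sub_iff_add_eq, lieD_add_lieD_of_eventually hX hZ hp]
  exact S.contact.lieD_hamVField S.smooth_H p

theorem SplitsXHNear.lieD_Ω (hS : S.SplitsXHNear X Z) (hX : IsSmoothVField X)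
    (hZ : IsSmoothVField Z) (m : M) :
    lieD X S.Ω (S.ι m) = -(((n + 1 : ℝ) * S.RH (S.ι m)) • S.Ω (S.ι m))
      - wedge (lieD Z S.η (S.ι m)) (wedgePow (d S.η (S.ι m)) n)
      - wedgeCross (S.η (S.ι m)) (d S.η (S.ι m)) (d (lieD Z S.η) (S.ι m)) n :=
  lieD_volumeForm_of_eventually hX S.contact.smooth (S.contact.smooth.lieD hZ) S.contMDiff_RH
    (hS.lieD_eventually hX hZ m)

/-- Along `M` one has `X(H) = -R(H) H`, whence this formula for `L_X (η / H)`. -/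
theorem SolvesConstrainedHerglotz.lieD_ηTilde (hX : S.SolvesConstrainedHerglotz X)
    (hmech : S.MechanicalCondition) (h0 : ∀ x, S.H x ≠ 0) (m : M) :
    lieD X S.ηTilde (S.ι m) =
      (S.H (S.ι m))⁻¹ • (lieD X S.η (S.ι m) + S.RH (S.ι m) • S.η (S.ι m)) := by
  rw [ConstrainedHamiltonianSystem.lieD_ηTilde h0, hX.dFun_apply hmech, smul_add, smul_smul]
  congr 2
  have := h0 (S.ι m)
  field_simp

theorem SolvesConstrainedHerglotz.lieD_ηTilde_apply (hX : S.SolvesConstrainedHerglotz X)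
    (hmech : S.MechanicalCondition) (hc : ∀ m, IsCompl (S.orthL m) (S.TM m))
    (hZ : S.ExtendsQXH Z) (h0 : ∀ x, S.H x ≠ 0) (m : M)
    {v : TangentSpace 𝓘(ℝ, E) (S.ι m)} (hv : v ∈ S.TM m) :
    oneForm (lieD X S.ηTilde (S.ι m)) v =
      -((S.H (S.ι m))⁻¹ * oneForm (lieD Z S.η (S.ι m)) v) := by
  rw [hX.lieD_ηTilde hmech h0]
  change (S.H (S.ι m))⁻¹ * (oneForm (lieD X S.η (S.ι m)) v +
    S.RH (S.ι m) * oneForm (S.η (S.ι m)) v) = _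
  rw [hX.lieD_apply hc hZ m hv]
  ring

/-- `L_X (η / H) = -L_Z (η / H)` near `M`, from `L_{X_H} (η / H) = 0`. The vanishing coefficient puts
the formula into the shape used for volumes. -/
theorem SplitsXHNear.lieD_ηTilde_eventually (hS : S.SplitsXHNear X Z) (hX : IsSmoothVField X)
    (hZ : IsSmoothVField Z) (h0 : ∀ x, S.H x ≠ 0) (m : M) :
    ∀ᶠ p in 𝓝 (S.ι m), lieD X S.ηTilde p = -((0 : ℝ) • S.ηTilde p) - lieD Z S.ηTilde p := by
  filter_upwards [(hS m).eventually_nhds] with p hp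
  rw [eq_sub_iff_add_eq, lieD_add_lieD_of_eventually hX hZ hp, zero_smul, neg_zero]
  exact S.contact.lieD_hamVField_inv_smul S.smooth_H h0 (S.smooth_H.inv₀ h0) p

theorem SplitsXHNear.lieD_ΩTilde (hS : S.SplitsXHNear X Z) (hX : IsSmoothVField X)
    (hZ : IsSmoothVField Z) (h0 : ∀ x, S.H x ≠ 0) (m : M) :
    lieD X S.ΩTilde (S.ι m) =
      -wedge (lieD Z S.ηTilde (S.ι m)) (wedgePow (d S.ηTilde (S.ι m)) n)
      - wedgeCross (S.ηTilde (S.ι m)) (d S.ηTilde (S.ι m)) (d (lieD Z S.ηTilde) (S.ι m)) n := by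
  have hs := S.isSmoothForm_ηTilde h0
  have h := lieD_volumeForm_of_eventually hX hs (hs.lieD hZ) contMDiff_const
    (hS.lieD_ηTilde_eventually hX hZ h0 m) (n := n)
  rw [mul_zero, zero_smul, neg_zero, zero_sub] at h
  exact h

/-- If the Reeb field `R` lies in `F`, then `0 = ♭(Z)(R) = η(Z)` along `M`. -/
theorem ExtendsQXH.oneForm_eq_zero (hZ : S.ExtendsQXH Z) (hX : S.SolvesConstrainedHerglotz X)
    (hc : ∀ m, IsCompl (S.orthL m) (S.TM m)) (hR : ∀ m, S.R (S.ι m) ∈ S.F m) (m : M) :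
    oneForm (S.η (S.ι m)) (Z (S.ι m)) = 0 := by
  have h : flat S.η (S.ι m) (Z (S.ι m)) (S.R (S.ι m)) = 0 :=
    (Submodule.mem_dualAnnihilator _).1 (hZ.mem_orthL hX hc m) _ (hR m)
  obtain ⟨h1, h2⟩ := S.contact.reeb_spec (S.ι m)
  rw [flat_apply, R, two_form_swap, h2, h1] at h
  linarith

/-- If the Reeb field lies in `F`, then `♭(Z) = ι_Z dη` along `M`, and this annihilates `F`. -/
theorem ExtendsQXH.d_apply_eq_zero (hZ : S.ExtendsQXH Z) (hX : S.SolvesConstrainedHerglotz X)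
    (hc : ∀ m, IsCompl (S.orthL m) (S.TM m)) (hR : ∀ m, S.R (S.ι m) ∈ S.F m) (m : M)
    {v : TangentSpace 𝓘(ℝ, E) (S.ι m)} (hv : v ∈ S.F m) :
    d S.η (S.ι m) ![Z (S.ι m), v] = 0 := by
  have h : flat S.η (S.ι m) (Z (S.ι m)) v = 0 :=
    (Submodule.mem_dualAnnihilator _).1 (hZ.mem_orthL hX hc m) _ hv
  rwa [flat_apply, hZ.oneForm_eq_zero hX hc hR, zero_mul, add_zero] at h

theorem ExtendsQXH.lieD_apply_eq_zero (hZ : S.ExtendsQXH Z) (hX : S.SolvesConstrainedHerglotz X)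
    (hc : ∀ m, IsCompl (S.orthL m) (S.TM m)) (hR : ∀ m, S.R (S.ι m) ∈ S.F m) (m : M)
    {v : TangentSpace 𝓘(ℝ, E) (S.ι m)} (hv : v ∈ S.F m ⊓ S.TM m) :
    oneForm (lieD Z S.η (S.ι m)) v = 0 := by
  obtain ⟨hF, u, rfl⟩ := hv
  have h0 : ContMDiff 𝓘(ℝ, E) 𝓘(ℝ, ℝ) ∞ fun _ : P => (0 : ℝ) := contMDiff_const
  -- `η(Z)` vanishes on `M`, hence so does its differential on `TM`
  have h := dFun_eq_of_eqOn_range (contMDiff_pairing S.contact.smooth hZ.smooth) h0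
    S.embedding.contMDiff (hZ.oneForm_eq_zero hX hc hR) m u
  rw [lieD_one_eq_cartan hZ.smooth S.contact.smooth]
  refine (congrArg₂ (· + ·) (hZ.d_apply_eq_zero hX hc hR m hF) h).trans ?_
  rw [dFun, mfderiv_const]
  exact zero_add 0

end ConstrainedHamiltonianSystem

end ContactNonholonomic

theorem proposition39 {n : ℕ}
    {E : Type*} [NormedAddCommGroup E] [NormedSpace ℝ E] [FiniteDimensional ℝ E]
    {P : Type*} [TopologicalSpace P] [ChartedSpace E P] [IsManifold 𝓘(ℝ, E) ∞ P]
    {E' : Type*} [NormedAddCommGroup E'] [NormedSpace ℝ E'] [FiniteDimensional ℝ E']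
    {M : Type*} [TopologicalSpace M] [ChartedSpace E' M] [IsManifold 𝓘(ℝ, E') ∞ M]
    (S : ConstrainedHamiltonianSystem E P E' M n)
    (hmech : S.MechanicalCondition)
    (huniq : ∀ m, S.orthL m ⊓ S.TM m = ⊥)
    (hrank : S.rankF = Module.finrank ℝ E')
    (X : VField E P) (hX : S.SolvesConstrainedHerglotz X) :
    -- the splitting of `T_M P`, and `X = 𝒫(X_H)`, so that `X_H - X` is an extension of `𝒬(X_H)`
    (∀ m, IsCompl (S.orthL m) (S.TM m)) ∧
    (∀ m, X (S.ι m) = S.projP m (S.XH (S.ι m))) ∧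
    S.ExtendsQXH (fun x => S.XH x - X x) ∧
    -- energy
    (∀ m, dFun S.H (S.ι m) (X (S.ι m)) =
      -(S.RH (S.ι m) * S.H (S.ι m)) - dFun S.H (S.ι m) (S.projQ m (S.XH (S.ι m)))) ∧
    ∀ Z : VField E P, S.ExtendsQXH Z →
      -- arbitrary extension `Z` of `𝒬(X_H)`: identities of 1-forms on `TM`
      (∀ m, ∀ v ∈ S.TM m, oneForm (lieD X S.η (S.ι m)) v =
        -(S.RH (S.ι m) * oneForm (S.η (S.ι m)) v) - oneForm (lieD Z S.η (S.ι m)) v) ∧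
      ((∀ x, S.H x ≠ 0) → ∀ m, ∀ v ∈ S.TM m, oneForm (lieD X S.ηTilde (S.ι m)) v =
        -((S.H (S.ι m))⁻¹ * oneForm (lieD Z S.η (S.ι m)) v)) ∧
      -- extension with `X + Z = X_H` near `M`: identities of forms on `T_M P`
      (S.SplitsXHNear X Z → ∀ m,
        lieD X S.η (S.ι m) = -(S.RH (S.ι m) • S.η (S.ι m)) - lieD Z S.η (S.ι m) ∧
        lieD X S.Ω (S.ι m) = -(((n + 1 : ℝ) * S.RH (S.ι m)) • S.Ω (S.ι m))
          - wedge (lieD Z S.η (S.ι m)) (wedgePow (d S.η (S.ι m)) n)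
          - wedgeCross (S.η (S.ι m)) (d S.η (S.ι m)) (d (lieD Z S.η) (S.ι m)) n) ∧
      (S.SplitsXHNear X Z → (∀ x, S.H x ≠ 0) → ∀ m,
        lieD X S.ηTilde (S.ι m) = -((S.H (S.ι m))⁻¹ • lieD Z S.η (S.ι m)) ∧
        lieD X S.ΩTilde (S.ι m) =
          -wedge (lieD Z S.ηTilde (S.ι m)) (wedgePow (d S.ηTilde (S.ι m)) n)
          - wedgeCross (S.ηTilde (S.ι m)) (d S.ηTilde (S.ι m)) (d (lieD Z S.ηTilde) (S.ι m)) n) ∧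
      -- the case in which the Reeb vector field is in `F`
      ((∀ m, S.R (S.ι m) ∈ S.F m) →
        (∀ m, ∀ v ∈ S.F m ⊓ S.TM m, oneForm (lieD Z S.η (S.ι m)) v = 0) ∧
        (S.HorizontalNear Z →
          (∀ m, oneForm (lieD Z S.η (S.ι m)) ∈ (S.F m).dualAnnihilator) ∧
          (S.SplitsXHNear X Z → ∀ m,
            lieD X S.Ω (S.ι m) = -(((n + 1 : ℝ) * S.RH (S.ι m)) • S.Ω (S.ι m))
              - wedgeCross (S.η (S.ι m)) (d S.η (S.ι m)) (d (lieD Z S.η) (S.ι m)) n) ∧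
          (S.SplitsXHNear X Z → (∀ x, S.H x ≠ 0) → ∀ m,
            lieD X S.ΩTilde (S.ι m) =
              -wedgeCross (S.ηTilde (S.ι m)) (d S.ηTilde (S.ι m))
                (d (lieD Z S.ηTilde) (S.ι m)) n))) := by
  have hc := S.isCompl_orthL_TM huniq hrank
  refine ⟨hc, fun m => (hX.projP_eq (hc m)).symm, hX.extendsQXH hc, hX.energy hmech hc,
    fun Z hZ => ⟨fun m v hv => hX.lieD_apply hc hZ m hv,
      fun h0 m v hv => hX.lieD_ηTilde_apply hmech hc hZ h0 m hv,
      fun hS m => ⟨(hS.lieD_eventually hX.smooth hZ.smooth m).self_of_nhds,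
        hS.lieD_Ω hX.smooth hZ.smooth m⟩,
      fun hS h0 m => ⟨?_, hS.lieD_ΩTilde hX.smooth hZ.smooth h0 m⟩,
      fun hR => ⟨fun m v hv => hZ.lieD_apply_eq_zero hX hc hR m hv,
        fun hhor => ⟨fun m => ?_, fun hS m => ?_, fun hS h0 m => ?_⟩⟩⟩⟩
  · rw [hX.lieD_ηTilde hmech h0, (hS.lieD_eventually hX.smooth hZ.smooth m).self_of_nhds]
    module
  · refine (Submodule.mem_dualAnnihilator _).2 fun v hv => ?_
    rw [lieD_one_apply_of_horizontal hZ.smooth S.contact.smooth (hhor m)]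
    exact hZ.d_apply_eq_zero hX hc hR m hv
  · rw [hS.lieD_Ω hX.smooth hZ.smooth, wedge_lieD_wedgePow_of_horizontal S.contact.finrank_eq
      hZ.smooth S.contact.smooth (hhor m), sub_zero]
  · have hη : ∀ᶠ p in 𝓝 (S.ι m), oneForm (S.ηTilde p) (Z p) = 0 := by
      filter_upwards [hhor m] with p hp
      exact (congrArg ((S.H p)⁻¹ * ·) hp).trans (mul_zero _)
    rw [hS.lieD_ΩTilde hX.smooth hZ.smooth h0, wedge_lieD_wedgePow_of_horizontal
      S.contact.finrank_eq hZ.smooth (S.isSmoothForm_ηTilde h0) hη, neg_zero, zero_sub]
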